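/- **Setting.** Fix a set of node names with at least two elements, a non-empty set of channels and an infinite set of values. Data expressions denote arbitrary functions of their variables. Probabilistic processes $p,q$, states $s,t$ and systems $M,N$ are given by $$p ::= s \mid p\,{}_{r}\!\oplus q,\qquad s ::= c!\langle e\rangle.p \mid c?(x).p \mid \omega \mid s+t \mid \mathsf{if}\ b\ \mathsf{then}\ s\ \mathsf{else}\ t \mid \tau.p \mid A\langle\tilde e\rangle \mid \mathbf 0,\qquad M ::= n[\![s]\!] \mid M|N \mid \mathbf 0,$$ where $r\in[0,1]$ and the names $A$ range over the members of all finite systems of (possibly mutually recursive) definitions $A(\tilde x)\Leftarrow s$. A network $\mathcal M=\Gamma\triangleright M$ is a closed system $M$, in which no node name occurs twice, with a finite irreflexive digraph $\Gamma$ that contains the set $\mathrm{nodes}(M)$ of the node names occurring in $M$; an edge $m\to n$ means that $n$ detects the broadcasts of $m$. The other nodes of $\Gamma$ are external: an external node is an input node if it has an outgoing edge, and an output node if it has an incoming one. The set $\mathbf{Nets}$ of well-formed networks consists of those in which every edge has an end in $\mathrm{nodes}(M)$ and every external node has an edge. The transitions $\Gamma\triangleright M\xrightarrow{\mu}\Delta$,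 with $\mu$ one of $n.\tau$, $n.c!v$, $n.c?v$ and $\Delta$ a distribution of systems, are those of probabilistic processes with lossless broadcast: a broadcast of $n$ on $c$ is received, in the same step, by exactly the nodes $m$ with $n\to m$ whose code can currently receive on $c$. A network is successful if the code of one of its nodes is structurally congruent to $\omega+s$ for some $s$. **May-testing.** Given a relation $\to$ from states to distributions, lifted to sub-distributions by finite sub-convex combinations, $\Delta\Rightarrow\sum_k\Delta_k^{\times}$ (a hyper-derivation) if $\Delta=\Delta_0^{\to}+\Delta_0^{\times}$ and $\Delta_k^{\to}\to\Delta_{k+1}^{\to}+\Delta_{k+1}^{\times}$ for all $k\ge0$, where no $\Delta_k^{\to}$ has a successful state in its support; it is extreme if every state in the support of the result that has a $\to$-transition is successful. $\mathrm{Results}(\mathcal M)$ is the set of the total masses that extreme derivatives of $\mathcal M$ give to successful networks, for the relation $\to$ made of all $n.\tau$ and $n.c!v$ transitions. The composition of $\Gamma\triangleright M$ with $\Gamma'\triangleright T$ is $(\Gamma\cup\Gamma')\triangleright(M|T)$, defined if no node of $\Gamma'$ is in $\mathrm{nodes}(M)$. For $\mathcal M,\mathcal N\in\mathbf{Nets}$,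 $\mathcal M\sqsubseteq_{may}\mathcal N$ means that $\mathcal M,\mathcal N$ have the same input nodes and the same output nodes and that, for every $\mathcal T\in\mathbf{Nets}$ whose compositions with $\mathcal M$ and with $\mathcal N$ are both defined, every result of the composition of $\mathcal M$ with $\mathcal T$ is $\le$ some result of the composition of $\mathcal N$ with $\mathcal T$. **Extensional actions and simulations.** These are performed by unsuccessful networks only. The action $\tau$ is a transition $n.\tau$, or a transition $n.c!v$ that reaches no external node; the action $n.c?v$ is a transition with that label, for an input node $n$; the action $c!v\triangleright\eta$ is a transition $m.c!v$ for some $m$, where $\eta\ne\emptyset$ is the set of the output nodes $n$ with $m\to n$. Let $\Rightarrow$ be hyper-derivation for the extensional $\tau$. The weak action $\stackrel{\tau}{\Rightarrow}$ is $\Rightarrow$; for $\lambda\neq\tau$, $\stackrel{\lambda}{\Rightarrow}$ contains $\Rightarrow\xrightarrow{\lambda}\Rightarrow$, and for outputs these are the least relations such that moreover $\mathcal M\stackrel{c!v\triangleright\eta_1}{\Longrightarrow}\Delta'\stackrel{c!v\triangleright\eta_2}{\Longrightarrow}\Delta$ with $\eta_1\cap\eta_2=\emptyset$ implies $\mathcal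 M\stackrel{c!v\triangleright(\eta_1\cup\eta_2)}{\Longrightarrow}\Delta$. For a relation $R$ from states to distributions, $\overline R$ is the least relation between distributions that contains $(\overline s,\Theta)$ whenever $s\,R\,\Theta$ and is closed under finite convex combinations; $\overline s$ is the point distribution at $s$. The simulation preorder $\sqsubseteq_{sim}$ is the largest relation on $\mathbf{Nets}$ such that $\mathcal M\sqsubseteq_{sim}\mathcal N$ implies: $\mathcal M$ and $\mathcal N$ have the same input nodes and the same output nodes; if $\mathcal M$ is successful, then $\mathcal N\Rightarrow\Theta$ for some distribution $\Theta$ supported on successful networks; otherwise, for every action $\lambda$ and every distribution $\Delta$ with $\mathcal M\stackrel{\lambda}{\Rightarrow}\Delta$ there is a distribution $\Theta$ with $\mathcal N\stackrel{\lambda}{\Rightarrow}\Theta$ such that $(\Delta,\Theta)$ belongs to the lifting of $\{(\mathcal L,\overline{\mathcal K}) : \mathcal L\sqsubseteq_{sim}\mathcal K\}$. A $\tau$-simulation is a relation $R\subseteq\mathbf{Nets}\times\mathcal D(\mathbf{Nets})$ such that $\mathcal M\,R\,\Theta$ implies: $\mathcal M$ has the same input nodes and the same output nodes as every network in the support of $\Theta$;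 and for every extensional action $\mathcal M\xrightarrow{\tau}\Delta$ there is a distribution $\Theta'$ with $\Theta\Rightarrow\Theta'$ and $\Delta\,\overline R\,\Theta'$. **Theorem 8.2.** There is no $\tau$-simulation $R$ such that, for all $\mathcal M,\mathcal N\in\mathbf{Nets}$, $$\mathcal M\sqsubseteq_{may}\mathcal N\iff \mathcal M\,R\,\overline{\mathcal N}.$$ Moreover the simulation preorder is incomplete for may-testing, with the same witnesses: there are $\mathcal M,\mathcal N\in\mathbf{Nets}$ such that $\mathcal M\sqsubseteq_{may}\mathcal N$ and $\mathcal M\not\sqsubseteq_{sim}\mathcal N$, while $\mathcal M\,R\,\overline{\mathcal N}$ fails for every $\tau$-simulation $R$ such that $\mathcal L\,R\,\overline{\mathcal K}$ always implies $\mathcal L\sqsubseteq_{may}\mathcal K$. -/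

import Mathlib

open scoped ENNReal

universe u v w

noncomputable section

namespace WNet

/-! ### Sub-distributions, lifted relations, hyper-derivations

Full distributions are Mathlib's `PMF`. -/

section Probability

variable {S T : Type*}

/-- A sub-distribution over `S`: a function into `[0,1]` of total mass at most one. -/
structure SubDist (S : Type*) where
  toFun : S → ℝ≥0∞
  tsum_le_one : ∑' s, toFun s ≤ 1

instance : CoeFun (SubDist S) (fun _ => S → ℝ≥0∞) := ⟨SubDist.toFun⟩

/-- A (full) distribution seen as a sub-distribution. -/
def SubDist.ofPMF (μ : PMF S) : SubDist S := ⟨fun s => μ s, μ.tsum_coe.le⟩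

/-- The distribution `p · μ + (1 - p) · ν`. -/
def mix (p : unitInterval) (μ ν : PMF S) : PMF S :=
  ⟨fun s => ENNReal.ofReal p * μ s + ENNReal.ofReal (1 - p) * ν s, by
    rw [ENNReal.summable.hasSum_iff, ENNReal.tsum_add, ENNReal.tsum_mul_left,
      ENNReal.tsum_mul_left, μ.tsum_coe, ν.tsum_coe, mul_one, mul_one,
      ← ENNReal.ofReal_add p.2.1 (sub_nonneg.2 p.2.2)]
    simp⟩

/-- The lifting of a relation from states to sub-distributions: the least relation that
contains it (on point distributions) and is closed under finite sub-convex combinations. -/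
inductive Lift (R : S → SubDist T → Prop) : SubDist S → SubDist T → Prop
  | point (s : S) (Θ : SubDist T) : R s Θ → Lift R (SubDist.ofPMF (PMF.pure s)) Θ
  | sum (n : ℕ) (p : Fin n → ℝ≥0∞) (Δs : Fin n → SubDist S) (Θs : Fin n → SubDist T)
      (Δ : SubDist S) (Θ : SubDist T) :
      (∑ i, p i ≤ 1) → (∀ i, Lift R (Δs i) (Θs i)) →
      (∀ s, Δ s = ∑ i, p i * Δs i s) → (∀ t, Θ t = ∑ i, p i * Θs i t) → Lift R Δ Θ

/-- The lifting of a relation from states to (full) distributions: the least relation that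
contains it (on point distributions) and is closed under finite convex combinations
(the weights form a distribution on `Fin n`, and `w.bind Δs` is `∑ i, w i · Δs i`). -/
inductive LiftDist (R : S → PMF T → Prop) : PMF S → PMF T → Prop
  | point (s : S) (Θ : PMF T) : R s Θ → LiftDist R (PMF.pure s) Θ
  | sum (n : ℕ) (w : PMF (Fin n)) (Δs : Fin n → PMF S) (Θs : Fin n → PMF T) :
      (∀ i, LiftDist R (Δs i) (Θs i)) → LiftDist R (w.bind Δs) (w.bind Θs)

/-- The relation `Rᵉ` from states to distributions induced by a relation between states. -/
def pointRel (R : S → T → Prop) (s : S) (Θ : PMF T) : Prop := ∃ t, Θ = PMF.pure t ∧ R s t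

/-- A relation from states to distributions, seen as one from states to sub-distributions. -/
def toSub (R : S → PMF T → Prop) (s : S) (Θ : SubDist T) : Prop :=
  ∃ μ : PMF T, R s μ ∧ Θ = SubDist.ofPMF μ

/-- A testing structure: a reduction relation from states to distributions and a
success predicate. -/
structure TestingStructure (S : Type*) where
  red : S → PMF S → Prop
  success : S → Prop

/-- `P.HyperDer Δ Δ'`: the sub-distribution `Δ'` is a hyper-derivative of `Δ`. Here `go k` is the
part that proceeds after `k` steps and `halt k` the part that stops there. -/
def TestingStructure.HyperDer (P : TestingStructure S) (Δ Δ' : SubDist S) : Prop :=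
  ∃ go halt : ℕ → SubDist S,
    (∀ s, Δ s = go 0 s + halt 0 s) ∧
    (∀ k, ∃ mid : SubDist S, Lift (toSub P.red) (go k) mid ∧
      ∀ s, mid s = go (k + 1) s + halt (k + 1) s) ∧
    (∀ k s, go k s ≠ 0 → ¬ P.success s) ∧
    ∀ s, Δ' s = ∑' k, halt k s

/-- `P.ExtremeDer Δ Δ'`: the sub-distribution `Δ'` is an extreme derivative of `Δ`. -/
def TestingStructure.ExtremeDer (P : TestingStructure S) (Δ Δ' : SubDist S) : Prop :=
  P.HyperDer Δ Δ' ∧ ∀ s, Δ' s ≠ 0 → (∃ μ, P.red s μ) → P.success s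

open Classical in
/-- The value of a sub-distribution: the mass that it gives to successful states. -/
def TestingStructure.value (P : TestingStructure S) (Δ : SubDist S) : ℝ≥0∞ :=
  ∑' s, if P.success s then Δ s else 0

/-- The set of possible results from a sub-distribution. -/
def TestingStructure.results (P : TestingStructure S) (Δ : SubDist S) : Set ℝ≥0∞ :=
  {r | ∃ Δ', P.ExtremeDer Δ Δ' ∧ r = P.value Δ'}

/-- The Hoare preorder on sets of outcomes. -/
def HoareLE (A B : Set ℝ≥0∞) : Prop := ∀ p ∈ A, ∃ q ∈ B, p ≤ q

end Probability

/-! ### Syntax of processes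

`Ch` is the set of channels and `Val` the set of closed values. Variables are well-scoped de Bruijn
indices: the terms with index `k` have their free variables among `0, …, k-1`, so that
closed terms are those of index `0`, and in `c?(x).p` the bound variable is the index `0` of `p`. -/

/-- A data expression with `k` free variables, given by its value as a function of theirs. -/
abbrev Expr (Val : Type*) (k : ℕ) := (Fin k → Val) → Val

/-- A boolean data expression with `k` free variables. -/
abbrev BExpr (Val : Type*) (k : ℕ) := (Fin k → Val) → Bool

mutual

/-- (Probabilistic) processes, over a set `N` of definition names with arities `ar`. -/
inductive Proc (Ch Val : Type u) (N : Type v) (ar : N → ℕ) : ℕ → Type (max u v)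
  | state {k : ℕ} (s : St Ch Val N ar k) : Proc Ch Val N ar k
  | choice {k : ℕ} (p : unitInterval) (P Q : Proc Ch Val N ar k) : Proc Ch Val N ar k

/-- States. -/
inductive St (Ch Val : Type u) (N : Type v) (ar : N → ℕ) : ℕ → Type (max u v)
  | nil {k : ℕ} : St Ch Val N ar k
  | omega {k : ℕ} : St Ch Val N ar k
  | snd {k : ℕ} (c : Ch) (e : Expr Val k) (P : Proc Ch Val N ar k) : St Ch Val N ar k
  | rcv {k : ℕ} (c : Ch) (P : Proc Ch Val N ar (k + 1)) : St Ch Val N ar k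
  | add {k : ℕ} (s t : St Ch Val N ar k) : St Ch Val N ar k
  | ite {k : ℕ} (b : BExpr Val k) (s t : St Ch Val N ar k) : St Ch Val N ar k
  | tau {k : ℕ} (P : Proc Ch Val N ar k) : St Ch Val N ar k
  | call {k : ℕ} (A : N) (es : Fin (ar A) → Expr Val k) : St Ch Val N ar k

end

section Terms

variable {Ch Val : Type u} {N : Type v} {ar : N → ℕ} {N' : Type w} {ar' : N' → ℕ}

/-- The extension of a substitution under a binder. -/
def up {j k : ℕ} (σ : Fin j → Expr Val k) : Fin (j + 1) → Expr Val (k + 1) :=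
  Fin.cases (fun ρ => ρ 0) (fun i ρ => σ i (fun l => ρ l.succ))

mutual

/-- Simultaneous substitution of data expressions for the free variables of a process. -/
def Proc.subst {j k : ℕ} (σ : Fin j → Expr Val k) : Proc Ch Val N ar j → Proc Ch Val N ar k
  | .state s => .state (s.subst σ)
  | .choice p P Q => .choice p (P.subst σ) (Q.subst σ)

/-- Simultaneous substitution of data expressions for the free variables of a state. -/
def St.subst {j k : ℕ} (σ : Fin j → Expr Val k) : St Ch Val N ar j → St Ch Val N ar k
  | .nil => .nil
  | .omega => .omega
  | .snd c e P => .snd c (fun ρ => e (fun i => σ i ρ)) (P.subst σ)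
  | .rcv c P => .rcv c (P.subst (up σ))
  | .add s t => .add (s.subst σ) (t.subst σ)
  | .ite b s t => .ite (fun ρ => b (fun i => σ i ρ)) (s.subst σ) (t.subst σ)
  | .tau P => .tau (P.subst σ)
  | .call A es => .call A (fun i ρ => es i (fun l => σ l ρ))

end

mutual

/-- Renaming of definition names. -/
def Proc.rename (f : N → N') {k : ℕ} :
    Proc Ch Val N (fun A => ar' (f A)) k → Proc Ch Val N' ar' k
  | .state s => .state (s.rename f)
  | .choice p P Q => .choice p (P.rename f) (Q.rename f)

/-- Renaming of definition names. -/
def St.rename (f : N → N') {k : ℕ} :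
    St Ch Val N (fun A => ar' (f A)) k → St Ch Val N' ar' k
  | .nil => .nil
  | .omega => .omega
  | .snd c e P => .snd c e (P.rename f)
  | .rcv c P => .rcv c (P.rename f)
  | .add s t => .add (s.rename f) (t.rename f)
  | .ite b s t => .ite b (s.rename f) (t.rename f)
  | .tau P => .tau (P.rename f)
  | .call A es => .call (f A) es

end

/-- The distribution of states denoted by a process. -/
def Proc.interp {k : ℕ} : Proc Ch Val N ar k → PMF (St Ch Val N ar k)
  | .state s => PMF.pure s
  | .choice p P Q => mix p P.interp Q.interp

end Terms

/-! ### Recursive definitions -/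

/-- A finite system of (possibly mutually recursive) parametrised definitions
`Aᵢ(x₁, …, xₙ) ⇐ sᵢ`, where `n = arity i` and the state `sᵢ = body i` may call every `Aⱼ`. -/
structure DefSys (Ch Val : Type u) where
  size : ℕ
  arity : Fin size → ℕ
  body : (i : Fin size) → St Ch Val (Fin size) arity (arity i)

/-- The names of the calculus: every member of every finite system of definitions has a name. -/
abbrev Name (Ch Val : Type u) := Σ D : DefSys Ch Val, Fin D.size

def Name.arity {Ch Val : Type u} (A : Name Ch Val) : ℕ := A.1.arity A.2

/-- Processes of the calculus with `k` free variables. -/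
abbrev ProcTerm (Ch Val : Type u) (k : ℕ) := Proc Ch Val (Name Ch Val) Name.arity k

/-- States of the calculus with `k` free variables. -/
abbrev State (Ch Val : Type u) (k : ℕ) := St Ch Val (Name Ch Val) Name.arity k

section Semantics

variable {Node Ch Val : Type u}

/-- The state `s` of the definition `A(x₁, …, xₙ) ⇐ s`. -/
def Name.body (A : Name Ch Val) : State Ch Val A.arity :=
  St.rename (ar' := Name.arity) (fun i : Fin A.1.size => (⟨A.1, i⟩ : Name Ch Val)) (A.1.body A.2)

/-- The value of a closed data expression. -/
def Expr.eval (e : Expr Val 0) : Val := e Fin.elim0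

/-- The truth value of a closed boolean data expression. -/
def BExpr.eval (b : BExpr Val 0) : Bool := b Fin.elim0

/-- `P{v/x}`, for the only free variable `x` of `P`. -/
def Proc.inst (P : ProcTerm Ch Val 1) (v : Val) : ProcTerm Ch Val 0 := P.subst (fun _ _ => v)

/-! ### Pre-semantics of states -/

/-- Actions of states: `c!v`, `c?v` and `τ`. -/
inductive StAct (Ch Val : Type u)
  | snd (c : Ch) (v : Val)
  | rcv (c : Ch) (v : Val)
  | tau

/-- The transitions of closed states. -/
inductive StStep : State Ch Val 0 → StAct Ch Val → PMF (State Ch Val 0) → Prop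
  | snd (c : Ch) (e : Expr Val 0) (P : ProcTerm Ch Val 0) :
      StStep (.snd c e P) (.snd c (Expr.eval e)) P.interp
  | rcv (c : Ch) (P : ProcTerm Ch Val 1) (v : Val) :
      StStep (.rcv c P) (.rcv c v) (P.inst v).interp
  | tau (P : ProcTerm Ch Val 0) : StStep (.tau P) .tau P.interp
  | sumL (s t : State Ch Val 0) (α : StAct Ch Val) (Δ : PMF (State Ch Val 0)) :
      StStep s α Δ → StStep (.add s t) α Δ
  | sumR (s t : State Ch Val 0) (α : StAct Ch Val) (Δ : PMF (State Ch Val 0)) :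
      StStep t α Δ → StStep (.add s t) α Δ
  | iteTrue (b : BExpr Val 0) (s t : State Ch Val 0) (α : StAct Ch Val)
      (Δ : PMF (State Ch Val 0)) :
      BExpr.eval b = true → StStep s α Δ → StStep (.ite b s t) α Δ
  | iteFalse (b : BExpr Val 0) (s t : State Ch Val 0) (α : StAct Ch Val)
      (Δ : PMF (State Ch Val 0)) :
      BExpr.eval b = false → StStep t α Δ → StStep (.ite b s t) α Δ
  | call (A : Name Ch Val) (es : Fin A.arity → Expr Val 0) (α : StAct Ch Val)
      (Δ : PMF (State Ch Val 0)) :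
      StStep (A.body.subst es) α Δ → StStep (.call A es) α Δ

/-- Structural congruence of closed states. -/
inductive StEquiv : State Ch Val 0 → State Ch Val 0 → Prop
  | refl (s : State Ch Val 0) : StEquiv s s
  | symm (s t : State Ch Val 0) : StEquiv s t → StEquiv t s
  | trans (s t u : State Ch Val 0) : StEquiv s t → StEquiv t u → StEquiv s u
  | congr (s s' t t' : State Ch Val 0) :
      StEquiv s s' → StEquiv t t' → StEquiv (.add s t) (.add s' t')
  | comm (s t : State Ch Val 0) : StEquiv (.add s t) (.add t s)
  | assoc (s t u : State Ch Val 0) : StEquiv (.add (.add s t) u) (.add s (.add t u))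
  | nil (s : State Ch Val 0) : StEquiv (.add s .nil) s
  | iteTrue (b : BExpr Val 0) (s t : State Ch Val 0) :
      BExpr.eval b = true → StEquiv (.ite b s t) s
  | iteFalse (b : BExpr Val 0) (s t : State Ch Val 0) :
      BExpr.eval b = false → StEquiv (.ite b s t) t
  | call (A : Name Ch Val) (es : Fin A.arity → Expr Val 0) :
      StEquiv (.call A es) (A.body.subst es)

/-! ### Systems and networks -/

/-- System terms: `node s n` is the node `n` running the code `s`. -/
inductive Sys (Node Ch Val : Type u)
  | nil
  | node (s : State Ch Val 0) (n : Node)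
  | par (M N : Sys Node Ch Val)

/-- The list of the occurrences of node names in a system term. -/
def Sys.nodeList : Sys Node Ch Val → List Node
  | .nil => []
  | .node _ n => [n]
  | .par M N => M.nodeList ++ N.nodeList

/-- The set of nodes occurring in a system term. -/
def Sys.nodes (M : Sys Node Ch Val) : Set Node := {n | n ∈ M.nodeList}

/-- Structural congruence of system terms. -/
inductive SysEquiv : Sys Node Ch Val → Sys Node Ch Val → Prop
  | refl (M : Sys Node Ch Val) : SysEquiv M M
  | symm (M N : Sys Node Ch Val) : SysEquiv M N → SysEquiv N M
  | trans (M N L : Sys Node Ch Val) : SysEquiv M N → SysEquiv N L → SysEquiv M L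
  | congr (M M' N N' : Sys Node Ch Val) :
      SysEquiv M M' → SysEquiv N N' → SysEquiv (.par M N) (.par M' N')
  | comm (M N : Sys Node Ch Val) : SysEquiv (.par M N) (.par N M)
  | assoc (M N L : Sys Node Ch Val) : SysEquiv (.par (.par M N) L) (.par M (.par N L))
  | nil (M : Sys Node Ch Val) : SysEquiv (.par M .nil) M
  | node (s t : State Ch Val 0) (n : Node) : StEquiv s t → SysEquiv (.node s n) (.node t n)

/-- A system term is successful if the success clause `ω` is enabled at one of its nodes. -/
def Sys.Success (M : Sys Node Ch Val) : Prop :=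
  ∃ (M' : Sys Node Ch Val) (s : State Ch Val 0) (n : Node),
    SysEquiv M (.par M' (.node (.add .omega s) n))

/-- A connectivity graph: a finite set of nodes with an irreflexive relation on it;
`conn m n` means that `n` can detect the broadcasts of `m`. -/
structure Graph (Node : Type u) where
  verts : Set Node
  finite : verts.Finite
  conn : Node → Node → Prop
  conn_left : ∀ m n, conn m n → m ∈ verts
  conn_right : ∀ m n, conn m n → n ∈ verts
  irrefl : ∀ n, ¬ conn n n

/-- The componentwise union of two connectivity graphs. -/
def Graph.union (Γ Γ' : Graph Node) : Graph Node where
  verts := Γ.verts ∪ Γ'.verts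
  finite := Γ.finite.union Γ'.finite
  conn m n := Γ.conn m n ∨ Γ'.conn m n
  conn_left m n h := h.imp (Γ.conn_left m n) (Γ'.conn_left m n)
  conn_right m n h := h.imp (Γ.conn_right m n) (Γ'.conn_right m n)
  irrefl n h := h.elim (Γ.irrefl n) (Γ'.irrefl n)

/-- A connectivity graph together with a system term. The side conditions that make such a pair
a (well-formed) network are collected in `Net.WellFormed`. -/
structure Net (Node Ch Val : Type u) where
  graph : Graph Node
  sys : Sys Node Ch Val

namespace Net

/-- The internal nodes, that is the nodes occupied by code. -/
def nodes (M : Net Node Ch Val) : Set Node := M.sys.nodes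

/-- The interface, whose elements are the external nodes. -/
def interface (M : Net Node Ch Val) : Set Node := M.graph.verts \ M.nodes

/-- The input nodes. -/
def inp (M : Net Node Ch Val) : Set Node := {i ∈ M.interface | ∃ m, M.graph.conn i m}

/-- The output nodes. -/
def outp (M : Net Node Ch Val) : Set Node := {o ∈ M.interface | ∃ m, M.graph.conn m o}

/-- Well-formed networks: every node name occurs at most once in the system term, the occupied
nodes are nodes of the graph, there is no connection between two external nodes, and every
external node is connected to some node. -/
structure WellFormed (M : Net Node Ch Val) : Prop where
  nodup : M.sys.nodeList.Nodup
  nodes_subset : M.nodes ⊆ M.graph.verts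
  internal : ∀ m n, M.graph.conn m n → m ∈ M.nodes ∨ n ∈ M.nodes
  connected : ∀ m ∈ M.graph.verts,
    (¬ ∃ n, M.graph.conn m n ∨ M.graph.conn n m) → m ∈ M.nodes

/-- The composition of the network `M` with the testing network `T` is defined. -/
def Composable (M T : Net Node Ch Val) : Prop := Disjoint M.nodes T.graph.verts

/-- The composition of `M` with the testing network `T` (meaningful if `M.Composable T`). -/
def comp (M T : Net Node Ch Val) : Net Node Ch Val := ⟨M.graph.union T.graph, .par M.sys T.sys⟩

end Net

/-! ### Intensional semantics -/

/-- Actions of systems: `n.c!v`, `n.c?v` and `n.τ`. -/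
inductive SysAct (Node Ch Val : Type u)
  | snd (n : Node) (c : Ch) (v : Val)
  | rcv (n : Node) (c : Ch) (v : Val)
  | tau (n : Node)

/-- The distribution of systems that places a distribution of states at the node `n`. -/
def nodeDist (Δ : PMF (State Ch Val 0)) (n : Node) : PMF (Sys Node Ch Val) :=
  Δ.map (fun s => .node s n)

/-- The parallel composition of two distributions of systems. -/
def parDist (Δ Θ : PMF (Sys Node Ch Val)) : PMF (Sys Node Ch Val) :=
  Δ.bind fun M => Θ.map fun N => .par M N

/-- The transitions of systems relative to a connectivity graph. -/
inductive SysStep (Γ : Graph Node) :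
    Sys Node Ch Val → SysAct Node Ch Val → PMF (Sys Node Ch Val) → Prop
  | broad (s : State Ch Val 0) (n : Node) (c : Ch) (v : Val) (Δ : PMF (State Ch Val 0)) :
      StStep s (.snd c v) Δ → SysStep Γ (.node s n) (.snd n c v) (nodeDist Δ n)
  | recv (s : State Ch Val 0) (m n : Node) (c : Ch) (v : Val) (Δ : PMF (State Ch Val 0)) :
      StStep s (.rcv c v) Δ → Γ.conn m n → SysStep Γ (.node s n) (.rcv m c v) (nodeDist Δ n)
  | deaf (s : State Ch Val 0) (m n : Node) (c : Ch) (v : Val) :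
      (¬ ∃ Δ, StStep s (.rcv c v) Δ) →
      SysStep Γ (.node s n) (.rcv m c v) (PMF.pure (.node s n))
  | disc (s : State Ch Val 0) (m n : Node) (c : Ch) (v : Val) :
      ¬ Γ.conn m n → SysStep Γ (.node s n) (.rcv m c v) (PMF.pure (.node s n))
  | nil (m : Node) (c : Ch) (v : Val) : SysStep Γ .nil (.rcv m c v) (PMF.pure .nil)
  | tau (s : State Ch Val 0) (n : Node) (Δ : PMF (State Ch Val 0)) :
      StStep s .tau Δ → SysStep Γ (.node s n) (.tau n) (nodeDist Δ n)
  | tauL (M N : Sys Node Ch Val) (n : Node) (Δ : PMF (Sys Node Ch Val)) :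
      SysStep Γ M (.tau n) Δ → SysStep Γ (.par M N) (.tau n) (parDist Δ (PMF.pure N))
  | tauR (M N : Sys Node Ch Val) (n : Node) (Δ : PMF (Sys Node Ch Val)) :
      SysStep Γ N (.tau n) Δ → SysStep Γ (.par M N) (.tau n) (parDist (PMF.pure M) Δ)
  | prop (M N : Sys Node Ch Val) (m : Node) (c : Ch) (v : Val) (Δ Θ : PMF (Sys Node Ch Val)) :
      SysStep Γ M (.rcv m c v) Δ → SysStep Γ N (.rcv m c v) Θ →
      SysStep Γ (.par M N) (.rcv m c v) (parDist Δ Θ)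
  | syncL (M N : Sys Node Ch Val) (m : Node) (c : Ch) (v : Val)
      (Δ Θ : PMF (Sys Node Ch Val)) :
      SysStep Γ M (.snd m c v) Δ → SysStep Γ N (.rcv m c v) Θ →
      SysStep Γ (.par M N) (.snd m c v) (parDist Δ Θ)
  | syncR (M N : Sys Node Ch Val) (m : Node) (c : Ch) (v : Val)
      (Δ Θ : PMF (Sys Node Ch Val)) :
      SysStep Γ M (.rcv m c v) Δ → SysStep Γ N (.snd m c v) Θ →
      SysStep Γ (.par M N) (.snd m c v) (parDist Δ Θ)

/-- `Γ ▷ Δ`: a distribution of systems executing relative to the connectivity graph `Γ`. -/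
def netDist (Γ : Graph Node) (Δ : PMF (Sys Node Ch Val)) : PMF (Net Node Ch Val) :=
  Δ.map (Net.mk Γ)

/-! ### May-testing -/

/-- Reductions of networks: some node performs an internal move or a broadcast. -/
def Net.Red (M : Net Node Ch Val) (D : PMF (Net Node Ch Val)) : Prop :=
  ∃ Δ, D = netDist M.graph Δ ∧
    ((∃ m ∈ M.nodes, SysStep M.graph M.sys (.tau m) Δ) ∨
      ∃ m c v, SysStep M.graph M.sys (.snd m c v) Δ)

/-- The testing structure of networks. -/
def netTS (Node Ch Val : Type u) : TestingStructure (Net Node Ch Val) where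
  red := Net.Red
  success M := M.sys.Success

/-- The set of possible outcomes of a network. -/
def Net.results (M : Net Node Ch Val) : Set ℝ≥0∞ :=
  (netTS Node Ch Val).results (SubDist.ofPMF (PMF.pure M))

/-- The may-testing preorder between well-formed networks. -/
def MayLE (M N : Net Node Ch Val) : Prop :=
  M.WellFormed ∧ N.WellFormed ∧ M.inp = N.inp ∧ M.outp = N.outp ∧
    ∀ T : Net Node Ch Val, T.WellFormed → M.Composable T → N.Composable T →
      HoareLE (M.comp T).results (N.comp T).results

/-! ### Extensional semantics -/

/-- Extensional actions: internal, input and output ones. -/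
inductive ExtAct (Node Ch Val : Type u)
  | tau
  | inp (n : Node) (c : Ch) (v : Val)
  | out (c : Ch) (v : Val) (η : Set Node)

/-- Strong extensional actions of networks; a successful network performs none. -/
inductive ExtStep (M : Net Node Ch Val) :
    ExtAct Node Ch Val → PMF (Net Node Ch Val) → Prop
  | tau (m : Node) (Δ : PMF (Sys Node Ch Val)) :
      ¬ M.sys.Success → SysStep M.graph M.sys (.tau m) Δ →
      ExtStep M .tau (netDist M.graph Δ)
  | silent (n : Node) (c : Ch) (v : Val) (Δ : PMF (Sys Node Ch Val)) :
      ¬ M.sys.Success → SysStep M.graph M.sys (.snd n c v) Δ →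
      (∀ m, M.graph.conn n m → m ∈ M.nodes) →
      ExtStep M .tau (netDist M.graph Δ)
  | inp (n : Node) (c : Ch) (v : Val) (Δ : PMF (Sys Node Ch Val)) :
      ¬ M.sys.Success → SysStep M.graph M.sys (.rcv n c v) Δ → n ∈ M.inp →
      ExtStep M (.inp n c v) (netDist M.graph Δ)
  | out (m : Node) (c : Ch) (v : Val) (η : Set Node) (Δ : PMF (Sys Node Ch Val)) :
      ¬ M.sys.Success → SysStep M.graph M.sys (.snd m c v) Δ →
      η = {n ∈ M.outp | M.graph.conn m n} → η.Nonempty →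
      ExtStep M (.out c v η) (netDist M.graph Δ)

/-- The internal part of the extensional probabilistic transition system of networks. -/
def extTS (Node Ch Val : Type u) : TestingStructure (Net Node Ch Val) where
  red M D := ExtStep M .tau D
  success M := M.sys.Success

/-- The strong extensional transitions lifted to sub-distributions of networks. -/
def ExtLift (a : ExtAct Node Ch Val) :
    SubDist (Net Node Ch Val) → SubDist (Net Node Ch Val) → Prop :=
  Lift (toSub fun M D => ExtStep M a D)

/-- The weak extensional actions `M ⟹ Δ`. A weak output to `η` may be split into a sequence of weak
outputs of the same value to disjoint sets of nodes with union `η`. In `multi`, the premise about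
`W` says that `Θ` is reached from `Δ` by the lifting of the weak output to `η₂`. -/
inductive WeakExt : Net Node Ch Val → ExtAct Node Ch Val → SubDist (Net Node Ch Val) → Prop
  | tau (M : Net Node Ch Val) (Δ : SubDist (Net Node Ch Val)) :
      (extTS Node Ch Val).HyperDer (SubDist.ofPMF (PMF.pure M)) Δ → WeakExt M .tau Δ
  | single (M : Net Node Ch Val) (a : ExtAct Node Ch Val)
      (Δ₁ Δ₂ Δ : SubDist (Net Node Ch Val)) :
      a ≠ .tau → (extTS Node Ch Val).HyperDer (SubDist.ofPMF (PMF.pure M)) Δ₁ →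
      ExtLift a Δ₁ Δ₂ → (extTS Node Ch Val).HyperDer Δ₂ Δ → WeakExt M a Δ
  | multi (M : Net Node Ch Val) (c : Ch) (v : Val) (η₁ η₂ : Set Node)
      (Δ Θ : SubDist (Net Node Ch Val))
      (W : Net Node Ch Val → SubDist (Net Node Ch Val) → Prop) :
      Disjoint η₁ η₂ → WeakExt M (.out c v η₁) Δ →
      (∀ L Ξ, W L Ξ → WeakExt L (.out c v η₂) Ξ) → Lift W Δ Θ →
      WeakExt M (.out c v (η₁ ∪ η₂)) Θ

/-! ### Simulations -/

/-- The clauses of the simulation preorder, for a relation between well-formed networks. -/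
def IsSimulation (S : Net Node Ch Val → Net Node Ch Val → Prop) : Prop :=
  ∀ M N, S M N → M.WellFormed ∧ N.WellFormed ∧ M.inp = N.inp ∧ M.outp = N.outp ∧
    (M.sys.Success → ∃ Θ : PMF (Net Node Ch Val), WeakExt N .tau (SubDist.ofPMF Θ) ∧
      ∀ L ∈ Θ.support, L.sys.Success) ∧
    (¬ M.sys.Success → ∀ (a : ExtAct Node Ch Val) (Δ : PMF (Net Node Ch Val)),
      WeakExt M a (SubDist.ofPMF Δ) →
      ∃ Θ : PMF (Net Node Ch Val), WeakExt N a (SubDist.ofPMF Θ) ∧ LiftDist (pointRel S) Δ Θ)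

/-- The simulation preorder, the largest simulation. -/
def SimLE (M N : Net Node Ch Val) : Prop := ∃ S, IsSimulation S ∧ S M N

/-- A `τ`-simulation: a relation between well-formed networks and distributions of well-formed
networks that preserves input and output nodes and matches every strong extensional
`τ`-action by a weak one. -/
def IsTauSimulation (R : Net Node Ch Val → PMF (Net Node Ch Val) → Prop) : Prop :=
  ∀ M Θ, R M Θ → M.WellFormed ∧ (∀ N ∈ Θ.support, N.WellFormed) ∧
    (∀ N ∈ Θ.support, M.inp = N.inp ∧ M.outp = N.outp) ∧
    ∀ Δ, ExtStep M .tau Δ → ∃ Θ' : PMF (Net Node Ch Val),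
      (extTS Node Ch Val).HyperDer (SubDist.ofPMF Θ) (SubDist.ofPMF Θ') ∧ LiftDist R Δ Θ'

end Semantics

end WNet

end

open WNet

noncomputable section

namespace WNet

-- Sub-distributions and normal forms of lifted relations.

section Probability

variable {S T : Type*}

theorem SubDist.ext' {Δ Θ : SubDist S} (h : ∀ s, Δ s = Θ s) : Δ = Θ := by
  cases Δ; cases Θ; congr; exact funext h

/-- The point sub-distribution. -/
def SubDist.point (s : S) : SubDist S := SubDist.ofPMF (PMF.pure s)

theorem SubDist.point_self (s : S) : SubDist.point s s = 1 := by
  simp [SubDist.point, SubDist.ofPMF]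

theorem SubDist.point_of_ne {s t : S} (h : t ≠ s) : SubDist.point s t = 0 := by
  simp [SubDist.point, SubDist.ofPMF, PMF.pure_apply, h]

theorem SubDist.tsum_point_mul (s : S) (w : S → ℝ≥0∞) :
    ∑' x, SubDist.point s x * w x = w s := by
  rw [tsum_eq_single s fun x hx => by rw [SubDist.point_of_ne hx, zero_mul],
    SubDist.point_self, one_mul]

/-- A finite sub-convex combination of sub-distributions. -/
def SubDist.comb {ι : Type*} [Fintype ι] (p : ι → ℝ≥0∞) (hp : ∑ i, p i ≤ 1)
    (Δs : ι → SubDist S) : SubDist S :=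
  ⟨fun s => ∑ i, p i * Δs i s, by
    rw [Summable.tsum_finsetSum fun _ _ => ENNReal.summable]
    simp_rw [ENNReal.tsum_mul_left]
    exact (Finset.sum_le_sum fun i _ => mul_le_of_le_one_right' (Δs i).tsum_le_one).trans hp⟩

/-- The restriction of a sub-distribution to the states with a given property. -/
def SubDist.restrict (p : S → Prop) (Δ : SubDist S) : SubDist S :=
  ⟨{s | p s}.indicator Δ,
    (ENNReal.tsum_le_tsum fun s => Set.indicator_le_self _ _ s).trans Δ.tsum_le_one⟩

/-- The zero sub-distribution. -/
def SubDist.zero : SubDist S := ⟨fun _ => 0, by simp⟩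

/-- Liftings are closed under sub-convex combinations over arbitrary finite index types. -/
theorem Lift.comb {R : S → SubDist T → Prop} {ι : Type*} [Fintype ι] (p : ι → ℝ≥0∞)
    (Δs : ι → SubDist S) (Θs : ι → SubDist T) {Δ : SubDist S} {Θ : SubDist T}
    (hp : ∑ i, p i ≤ 1) (h : ∀ i, Lift R (Δs i) (Θs i))
    (hΔ : ∀ s, Δ s = ∑ i, p i * Δs i s) (hΘ : ∀ t, Θ t = ∑ i, p i * Θs i t) : Lift R Δ Θ := by
  let e := Fintype.equivFin ι
  refine Lift.sum _ (p ∘ e.symm) (Δs ∘ e.symm) (Θs ∘ e.symm) _ _ ?_ (fun i => h _) ?_ ?_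
  · exact (Equiv.sum_comp e.symm p).trans_le hp
  · intro s
    rw [hΔ, ← Equiv.sum_comp e.symm]; rfl
  · intro s
    rw [hΘ, ← Equiv.sum_comp e.symm]; rfl

/-- The normal form of the elements of a lifted relation. -/
theorem Lift.exists_fintype {R : S → SubDist T → Prop} {Δ : SubDist S} {Θ : SubDist T}
    (h : Lift R Δ Θ) : ∃ (ι : Type) (_ : Fintype ι) (p : ι → ℝ≥0∞) (s : ι → S)
      (Ξ : ι → SubDist T), (∑ i, p i ≤ 1) ∧ (∀ i, R (s i) (Ξ i)) ∧
      (∀ x, Δ x = ∑ i, p i * SubDist.point (s i) x) ∧ ∀ y, Θ y = ∑ i, p i * Ξ i y := by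
  induction h with
  | point s Θ h =>
    exact ⟨Unit, inferInstance, fun _ => 1, fun _ => s, fun _ => Θ, by simp, fun _ => h,
      fun x => by simp [SubDist.point], fun y => by simp⟩
  | sum n p Δs Θs Δ Θ hp _ hΔ hΘ ih =>
    choose ι hι q s Ξ hq hR h1 h2 using ih
    refine ⟨Σ i, ι i, inferInstance, fun x => p x.1 * q x.1 x.2, fun x => s x.1 x.2,
      fun x => Ξ x.1 x.2, ?_, fun x => hR _ _, fun x => ?_, fun y => ?_⟩
    · rw [Fintype.sum_sigma]
      simp_rw [← Finset.mul_sum]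
      exact (Finset.sum_le_sum fun i _ => mul_le_of_le_one_right' (hq i)).trans hp
    · rw [hΔ, Fintype.sum_sigma]
      simp_rw [h1, mul_assoc, Finset.mul_sum]
    · rw [hΘ, Fintype.sum_sigma]
      simp_rw [h2, mul_assoc, Finset.mul_sum]

/-- The normal form of the elements of a lifted reduction relation. -/
theorem Lift.exists_fintype_toSub {R : S → PMF T → Prop} {Δ : SubDist S} {Θ : SubDist T}
    (h : Lift (toSub R) Δ Θ) : ∃ (ι : Type) (_ : Fintype ι) (p : ι → ℝ≥0∞) (s : ι → S)
      (μ : ι → PMF T), (∑ i, p i ≤ 1) ∧ (∀ i, R (s i) (μ i)) ∧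
      (∀ x, Δ x = ∑ i, p i * SubDist.point (s i) x) ∧ (∀ y, Θ y = ∑ i, p i * μ i y) ∧
      ∀ i, p i ≠ 0 → Δ (s i) ≠ 0 := by
  obtain ⟨ι, hι, p, s, Ξ, hp, hR, h1, h2⟩ := h.exists_fintype
  choose μ hμ hΞ using hR
  refine ⟨ι, hι, p, s, μ, hp, hμ, h1, fun y => ?_, fun i hi h0 => hi ?_⟩
  · rw [h2]
    simp_rw [hΞ]
    rfl
  · rw [h1, Finset.sum_eq_zero_iff] at h0
    simpa [SubDist.point_self] using h0 i (Finset.mem_univ i)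

/-- Every state of the source of a lifted reduction has a reduction into the target. -/
theorem Lift.exists_red_of_ne_zero {R : S → PMF T → Prop} {Δ : SubDist S} {Θ : SubDist T}
    (h : Lift (toSub R) Δ Θ) {s : S} (hs : Δ s ≠ 0) :
    ∃ μ, R s μ ∧ ∀ x, μ x ≠ 0 → Θ x ≠ 0 := by
  obtain ⟨ι, _, p, s', μ, -, hμ, e1, e2, -⟩ := h.exists_fintype_toSub
  rw [e1] at hs
  obtain ⟨i, -, hi⟩ := Finset.exists_ne_zero_of_sum_ne_zero hs
  obtain rfl : s = s' i := by
    by_contra hc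
    exact right_ne_zero_of_mul hi (SubDist.point_of_ne hc)
  refine ⟨μ i, hμ i, fun x hx h0 => ?_⟩
  rw [e2, Finset.sum_eq_zero_iff] at h0
  exact mul_ne_zero (left_ne_zero_of_mul hi) hx (h0 i (Finset.mem_univ i))

/-- Every state of the target of a lifted reduction is reached by a reduction from the source. -/
theorem Lift.exists_source_of_ne_zero {R : S → PMF T → Prop} {Δ : SubDist S} {Θ : SubDist T}
    (h : Lift (toSub R) Δ Θ) {x : T} (hx : Θ x ≠ 0) :
    ∃ s μ, Δ s ≠ 0 ∧ R s μ ∧ μ x ≠ 0 ∧ ∀ y, μ y ≠ 0 → Θ y ≠ 0 := by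
  obtain ⟨ι, _, p, s, μ, -, hμ, -, e2, e3⟩ := h.exists_fintype_toSub
  rw [e2] at hx
  obtain ⟨i, -, hi⟩ := Finset.exists_ne_zero_of_sum_ne_zero hx
  refine ⟨s i, μ i, e3 i (left_ne_zero_of_mul hi), hμ i, right_ne_zero_of_mul hi,
    fun y hy h0 => ?_⟩
  rw [e2, Finset.sum_eq_zero_iff] at h0
  exact mul_ne_zero (left_ne_zero_of_mul hi) hy (h0 i (Finset.mem_univ i))

theorem tsum_comb_mul {ι : Type*} [Fintype ι] (p : ι → ℝ≥0∞) (f : ι → S → ℝ≥0∞)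
    (w : S → ℝ≥0∞) : ∑' x, (∑ i, p i * f i x) * w x = ∑ i, p i * ∑' x, f i x * w x := by
  simp_rw [Finset.sum_mul, mul_assoc]
  rw [Summable.tsum_finsetSum fun _ _ => ENNReal.summable]
  simp_rw [ENNReal.tsum_mul_left]

-- Supermartingales and invariant sets along hyper-derivations.

namespace TestingStructure

variable (P : TestingStructure S)

/-- The weights in `w` do not increase along the reductions of unsuccessful states. -/
def Supermartingale (w : S → ℝ≥0∞) : Prop :=
  ∀ s μ, ¬ P.success s → P.red s μ → ∑' x, μ x * w x ≤ w s

variable {P}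

/-- In normal form a lifted step is a finite combination of steps from points, and the inequality is
linear in the combination. Only points of nonzero coefficient need to be unsuccessful. -/
theorem Supermartingale.lift_le {w : S → ℝ≥0∞} (hw : P.Supermartingale w) {Δ Θ : SubDist S}
    (h : Lift (toSub P.red) Δ Θ) (hs : ∀ s, Δ s ≠ 0 → ¬ P.success s) :
    ∑' x, Θ x * w x ≤ ∑' x, Δ x * w x := by
  obtain ⟨ι, _, p, s, μ, -, hμ, h1, h2, h3⟩ := h.exists_fintype_toSub
  simp_rw [h1, h2]
  rw [tsum_comb_mul p (fun i => μ i), tsum_comb_mul p (fun i => SubDist.point (s i))]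
  simp_rw [SubDist.tsum_point_mul]
  refine Finset.sum_le_sum fun i _ => ?_
  by_cases hi : p i = 0
  · simp [hi]
  · gcongr
    exact hw _ _ (hs _ (h3 i hi)) (hμ i)

/-- The expected weight does not increase along a hyper-derivation. -/
theorem Supermartingale.sum_halt_add_go_le {w : S → ℝ≥0∞} (hw : P.Supermartingale w)
    {Δ : SubDist S} {go halt : ℕ → SubDist S} (h0 : ∀ s, Δ s = go 0 s + halt 0 s)
    (h1 : ∀ k, ∃ mid : SubDist S, Lift (toSub P.red) (go k) mid ∧
      ∀ s, mid s = go (k + 1) s + halt (k + 1) s)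
    (h2 : ∀ k s, go k s ≠ 0 → ¬ P.success s) (n : ℕ) :
    (∑ k ∈ Finset.range (n + 1), ∑' x, halt k x * w x) + ∑' x, go n x * w x ≤
      ∑' x, Δ x * w x := by
  induction n with
  | zero =>
    rw [Finset.sum_range_one, ← ENNReal.tsum_add]
    simp_rw [← add_mul, h0, add_comm (halt 0 _)]
    exact le_rfl
  | succ n ih =>
    refine le_trans ?_ ih
    rw [Finset.sum_range_succ, add_assoc, ← ENNReal.tsum_add]
    refine add_le_add_right ?_ _
    obtain ⟨mid, hm, hm'⟩ := h1 n
    simp_rw [← add_mul, add_comm (halt (n + 1) _), ← hm']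
    exact hw.lift_le hm (h2 n)

/-- Every partial sum over the halting parts is bounded by the initial weight. The part still
proceeding is dropped, so weight may be lost to divergence. -/
theorem Supermartingale.hyperDer_le {w : S → ℝ≥0∞} (hw : P.Supermartingale w)
    {Δ Δ' : SubDist S} (h : P.HyperDer Δ Δ') : ∑' x, Δ' x * w x ≤ ∑' x, Δ x * w x := by
  obtain ⟨go, halt, h0, h1, h2, h3⟩ := h
  simp_rw [h3, ← ENNReal.tsum_mul_right]
  rw [ENNReal.tsum_comm]
  refine ENNReal.tsum_le_of_sum_range_le fun n => ?_
  cases n with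
  | zero => simp
  | succ n => exact le_self_add.trans (hw.sum_halt_add_go_le h0 h1 h2 n)

variable (P)

/-- A set of states that the reductions of its unsuccessful members do not leave. -/
def Closed (I : Set S) : Prop :=
  ∀ s ∈ I, ∀ μ, ¬ P.success s → P.red s μ → ∀ x, μ x ≠ 0 → x ∈ I

variable {P}

/-- From a member of `I` no mass leaves `I`, and elsewhere the total mass one is the bound. This
turns statements about supports into statements about weights. -/
theorem Closed.supermartingale {I : Set S} (hI : P.Closed I) :
    P.Supermartingale (Iᶜ.indicator 1) := by
  intro s μ hs hμ
  by_cases h : s ∈ I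
  · rw [ENNReal.tsum_eq_zero.2]
    · exact zero_le
    · intro x
      by_cases hx : μ x = 0
      · simp [hx]
      · simp [hI s h μ hs hμ x hx]
  · rw [Set.indicator_of_mem (show s ∈ Iᶜ from h)]
    calc _ ≤ ∑' x, μ x * 1 := by
          gcongr with x
          exact Set.indicator_le_self' (fun _ _ => zero_le) x
      _ ≤ _ := by simp [μ.tsum_coe]

theorem mem_of_tsum_indicator_eq_zero {I : Set S} {f : S → ℝ≥0∞}
    (h : ∑' x, f x * Iᶜ.indicator 1 x ≤ 0) {s : S} (hs : f s ≠ 0) : s ∈ I := by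
  by_contra hI
  have := ENNReal.tsum_eq_zero.1 (le_antisymm h (zero_le)) s
  rw [Set.indicator_of_mem (show s ∈ Iᶜ from hI)] at this
  simp [hs] at this

theorem tsum_indicator_le_zero {I : Set S} {f : S → ℝ≥0∞} (h : ∀ s, f s ≠ 0 → s ∈ I) :
    ∑' x, f x * Iᶜ.indicator 1 x ≤ 0 := by
  refine (ENNReal.tsum_eq_zero.2 fun x => ?_).le
  by_cases hx : f x = 0
  · simp [hx]
  · simp [h x hx]

theorem Closed.mem_of_hyperDer {I : Set S} (hI : P.Closed I) {Δ Δ' : SubDist S}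
    (h : P.HyperDer Δ Δ') (hΔ : ∀ s, Δ s ≠ 0 → s ∈ I) {s : S} (hs : Δ' s ≠ 0) : s ∈ I :=
  mem_of_tsum_indicator_eq_zero
    ((hI.supermartingale.hyperDer_le h).trans (tsum_indicator_le_zero hΔ)) hs

theorem Closed.mem_of_go {I : Set S} (hI : P.Closed I) {Δ : SubDist S}
    {go halt : ℕ → SubDist S} (h0 : ∀ s, Δ s = go 0 s + halt 0 s)
    (h1 : ∀ k, ∃ mid : SubDist S, Lift (toSub P.red) (go k) mid ∧
      ∀ s, mid s = go (k + 1) s + halt (k + 1) s)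
    (h2 : ∀ k s, go k s ≠ 0 → ¬ P.success s) (hΔ : ∀ s, Δ s ≠ 0 → s ∈ I) {k : ℕ} {s : S}
    (hs : go k s ≠ 0) : s ∈ I :=
  mem_of_tsum_indicator_eq_zero (le_add_self.trans
    ((hI.supermartingale.sum_halt_add_go_le h0 h1 h2 k).trans (tsum_indicator_le_zero hΔ))) hs

/-- A weight that does not increase along the reductions within a closed set does not increase
along hyper-derivations that start in this set. -/
theorem Closed.hyperDer_le {I : Set S} (hI : P.Closed I) {w : S → ℝ≥0∞}
    (hw : ∀ s ∈ I, ∀ μ, ¬ P.success s → P.red s μ → ∑' x, μ x * w x ≤ w s)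
    {Δ Δ' : SubDist S} (h : P.HyperDer Δ Δ') (hΔ : ∀ s, Δ s ≠ 0 → s ∈ I) :
    ∑' x, Δ' x * w x ≤ ∑' x, Δ x * w x := by
  classical
  have hcongr : ∀ f : S → ℝ≥0∞, (∀ s, f s ≠ 0 → s ∈ I) →
      ∑' x, f x * (if x ∈ I then w x else ∞) = ∑' x, f x * w x := by
    intro f hf
    refine tsum_congr fun x => ?_
    by_cases hx : f x = 0
    · simp [hx]
    · rw [if_pos (hf x hx)]
  -- The value `∞` outside `I` makes the inequality trivial there and is never seen by
  -- sub-distributions supported in `I`.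
  have hsuper : P.Supermartingale fun x => if x ∈ I then w x else ∞ := by
    intro s μ hs hμ
    by_cases h : s ∈ I
    · rw [hcongr μ (hI s h μ hs hμ)]
      simpa [h] using hw s h μ hs hμ
    · simp [h]
  rw [← hcongr Δ' fun s => hI.mem_of_hyperDer h hΔ, ← hcongr Δ hΔ]
  exact hsuper.hyperDer_le h

end TestingStructure

/-! ### Weighted images -/

open Classical in
/-- The image under `f` of the function `g`, weighted by `w`. -/
def pushW (f : S → T) (w : S → ℝ≥0∞) (g : S → ℝ≥0∞) (y : T) : ℝ≥0∞ :=
  ∑' x, if f x = y then g x * w x else 0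

theorem tsum_pushW (f : S → T) (w g : S → ℝ≥0∞) : ∑' y, pushW f w g y = ∑' x, g x * w x := by
  classical
  unfold pushW
  rw [ENNReal.tsum_comm]
  refine tsum_congr fun x => ?_
  rw [tsum_eq_single (f x) fun y hy => if_neg hy.symm, if_pos rfl]

theorem pushW_add (f : S → T) (w g h : S → ℝ≥0∞) (y : T) :
    pushW f w (fun x => g x + h x) y = pushW f w g y + pushW f w h y := by
  unfold pushW
  rw [← ENNReal.tsum_add]
  refine tsum_congr fun x => ?_
  split_ifs <;> simp [add_mul]

theorem pushW_sum {ι : Type*} [Fintype ι] (f : S → T) (w : S → ℝ≥0∞) (p : ι → ℝ≥0∞)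
    (g : ι → S → ℝ≥0∞) (y : T) :
    pushW f w (fun x => ∑ i, p i * g i x) y = ∑ i, p i * pushW f w (g i) y := by
  classical
  unfold pushW
  have := tsum_comb_mul p g fun x => if f x = y then w x else 0
  simpa [mul_ite] using this

theorem pushW_tsum (f : S → T) (w : S → ℝ≥0∞) (g : ℕ → S → ℝ≥0∞) (y : T) :
    pushW f w (fun x => ∑' k, g k x) y = ∑' k, pushW f w (g k) y := by
  classical
  unfold pushW
  rw [ENNReal.tsum_comm]
  refine tsum_congr fun x => ?_
  split_ifs <;> simp [ENNReal.tsum_mul_right]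

theorem pushW_point (f : S → T) (w : S → ℝ≥0∞) (s : S) (y : T) :
    pushW f w (SubDist.point s) y = w s * SubDist.point (f s) y := by
  classical
  unfold pushW
  have := SubDist.tsum_point_mul s fun x => if f x = y then w x else 0
  simp only [mul_ite, mul_zero] at this
  rw [this]
  split_ifs with h
  · rw [← h, SubDist.point_self, mul_one]
  · rw [SubDist.point_of_ne (Ne.symm h), mul_zero]

theorem exists_of_pushW_ne_zero {f : S → T} {w g : S → ℝ≥0∞} {y : T}
    (h : pushW f w g y ≠ 0) : ∃ x, f x = y ∧ g x ≠ 0 ∧ w x ≠ 0 := by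
  classical
  by_contra hc
  push Not at hc
  refine h (ENNReal.tsum_eq_zero.2 fun x => ?_)
  split_ifs with hx
  · by_cases h0 : g x = 0
    · simp [h0]
    · simp [hc x hx h0]
  · rfl

/-- A weighted functional simulation transports hyper-derivations. -/
theorem TestingStructure.HyperDer.exists_pushW {P : TestingStructure S} {Q : TestingStructure T}
    {I : Set S} (hI : P.Closed I) (f : S → T) (w : S → ℝ≥0∞)
    (hstep : ∀ s ∈ I, ∀ μ, ¬ P.success s → P.red s μ → w s ≠ 0 →
      ∃ ν, Q.red (f s) ν ∧ ∀ y, pushW f w μ y = w s * ν y)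
    (hzero : ∀ s ∈ I, ∀ μ, ¬ P.success s → P.red s μ → w s = 0 → ∀ x, μ x ≠ 0 → w x = 0)
    (hsucc : ∀ s ∈ I, w s ≠ 0 → Q.success (f s) → P.success s)
    {s₀ : S} (hs₀ : s₀ ∈ I) (hw : w s₀ = 1) {Δ' : SubDist S}
    (h : P.HyperDer (SubDist.point s₀) Δ') :
    ∃ Θ', Q.HyperDer (SubDist.point (f s₀)) Θ' ∧ ∀ y, Θ' y = pushW f w Δ' y := by
  classical
  obtain ⟨go, halt, h0, h1, h2, h3⟩ := h
  have hinit : ∀ s, SubDist.point s₀ s ≠ 0 → s ∈ I := by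
    intro s hs
    by_contra hc
    exact hs (SubDist.point_of_ne fun h => hc (h ▸ hs₀))
  have hgo : ∀ k s, go k s ≠ 0 → s ∈ I := fun k s => hI.mem_of_go h0 h1 h2 hinit
  choose mid hmid hmid' using h1
  -- Weights may exceed one, so the image of `go k` need not a priori be a sub-distribution. The
  -- bound is a hypothesis here and is established by induction in `hmass`, which uses the image
  -- step itself.
  have step : ∀ k, ∑' x, go k x * w x ≤ 1 →
      ∃ (Δ Θ : SubDist T), Lift (toSub Q.red) Δ Θ ∧ (∀ y, Δ y = pushW f w (go k) y) ∧
        (∀ y, Θ y = pushW f w (mid k) y) := by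
    intro k hk
    obtain ⟨ι, _, p, s, μ, hp, hμ, e1, e2, e3⟩ := (hmid k).exists_fintype_toSub
    -- Where the weighted coefficient vanishes there may be no reduction of `Q`; an arbitrary
    -- distribution is chosen, and both sides of the equation are zero.
    have key : ∀ i, ∃ ν, (p i * w (s i) ≠ 0 → Q.red (f (s i)) ν) ∧
        ∀ y, p i * pushW f w (μ i) y = p i * (w (s i) * ν y) := by
      intro i
      by_cases hi : p i = 0
      · exact ⟨PMF.pure (f s₀), fun h => absurd (by simp [hi]) h, by simp [hi]⟩
      have hg := e3 i hi
      by_cases hw0 : w (s i) = 0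
      · refine ⟨PMF.pure (f s₀), fun h => absurd (by simp [hw0]) h, fun y => ?_⟩
        rw [hw0, zero_mul, mul_zero]
        by_contra hc
        obtain ⟨x, -, hx, hwx⟩ := exists_of_pushW_ne_zero (right_ne_zero_of_mul hc)
        exact hwx (hzero _ (hgo _ _ hg) _ (h2 _ _ hg) (hμ i) hw0 x hx)
      · obtain ⟨ν, hν, h⟩ := hstep _ (hgo _ _ hg) _ (h2 _ _ hg) (hμ i) hw0
        exact ⟨ν, fun _ => hν, fun y => by rw [h]⟩
    choose ν hν hν' using key
    have hsum : ∑ i, p i * w (s i) ≤ 1 := by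
      refine le_trans (le_of_eq ?_) hk
      simp_rw [e1]
      rw [tsum_comb_mul p fun i => SubDist.point (s i)]
      simp_rw [SubDist.tsum_point_mul]
    -- The image step is formed from the indices that carry an actual reduction of `Q`; the others
    -- contribute nothing.
    let J := {i // p i * w (s i) ≠ 0}
    have hJ : ∀ g : ι → ℝ≥0∞, ∑ j : J, p j * w (s j) * g j = ∑ i, p i * w (s i) * g i := by
      intro g
      rw [← Finset.sum_filter_of_ne (p := fun i => p i * w (s i) ≠ 0)
        fun i _ hi => left_ne_zero_of_mul hi]
      exact (Finset.sum_subtype _ (by simp) fun i => p i * w (s i) * g i).symm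
    have hJ1 : ∑ j : J, p j * w (s j) ≤ 1 := by
      have := hJ fun _ => 1
      simp only [mul_one] at this
      rwa [this]
    refine ⟨SubDist.comb (fun j : J => p j * w (s j)) hJ1 fun j => SubDist.point (f (s j)),
      SubDist.comb (fun j : J => p j * w (s j)) hJ1 fun j => SubDist.ofPMF (ν j),
      Lift.comb _ _ _ hJ1 (fun j => Lift.point _ _ ⟨_, hν j j.2, rfl⟩) (fun _ => rfl) fun _ => rfl,
      fun y => ?_, fun y => ?_⟩
    · refine (hJ fun i => SubDist.point (f (s i)) y).trans ?_
      rw [show (go k : S → ℝ≥0∞) = fun x => ∑ i, p i * SubDist.point (s i) x from funext e1,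
        pushW_sum f w p fun i => SubDist.point (s i)]
      simp_rw [pushW_point, mul_assoc]
    · refine (hJ fun i => ν i y).trans ?_
      rw [show (mid k : S → ℝ≥0∞) = fun x => ∑ i, p i * μ i x from funext e2,
        pushW_sum f w p fun i => μ i]
      simp_rw [hν', mul_assoc]
  have hmass : ∀ k, ∑' x, go k x * w x ≤ 1 := by
    intro k
    induction k with
    | zero =>
      rw [← hw, ← SubDist.tsum_point_mul s₀ w]
      exact ENNReal.tsum_le_tsum fun x => by rw [h0]; gcongr; exact le_self_add
    | succ k ih =>
      obtain ⟨-, Θ, -, -, hΘ⟩ := step k ih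
      refine le_trans ?_ Θ.tsum_le_one
      simp_rw [hΘ]
      rw [tsum_pushW]
      exact ENNReal.tsum_le_tsum fun x => by rw [hmid']; gcongr; exact le_self_add
  choose Δ Θ hL hΔ hΘ using fun k => step k (hmass k)
  have h0' : ∀ y, SubDist.point (f s₀) y = Δ 0 y + pushW f w (halt 0) y := by
    intro y
    rw [hΔ, ← pushW_add, ← one_mul (SubDist.point (f s₀) y), ← hw, ← pushW_point]
    congr 1
    exact funext h0
  have h1' : ∀ k y, Θ k y = Δ (k + 1) y + pushW f w (halt (k + 1)) y := by
    intro k y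
    rw [hΔ, ← pushW_add, hΘ]
    congr 1
    exact funext (hmid' k)
  have hhalt : ∀ k, ∑' y, pushW f w (halt k) y ≤ 1 := by
    intro k
    cases k with
    | zero =>
      refine le_trans (ENNReal.tsum_le_tsum fun y => ?_) (SubDist.point (f s₀)).tsum_le_one
      rw [h0' y]
      exact le_add_self
    | succ k =>
      refine le_trans (ENNReal.tsum_le_tsum fun y => ?_) (Θ k).tsum_le_one
      rw [h1' k y]
      exact le_add_self
  have hgoT : ∀ k y, Δ k y ≠ 0 → ¬ Q.success y := by
    intro k y hy
    rw [hΔ] at hy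
    obtain ⟨x, rfl, hx, hwx⟩ := exists_of_pushW_ne_zero hy
    exact fun hs => h2 k x hx (hsucc x (hgo k x hx) hwx hs)
  -- The constant weight bounds the total mass that halts, so the image of `Δ'` is a
  -- sub-distribution.
  have hone : Q.Supermartingale fun _ => 1 := fun s μ _ _ => by simp [μ.tsum_coe]
  have hbound : ∑' y, pushW f w Δ' y ≤ 1 := by
    rw [tsum_pushW]
    simp_rw [h3, ← ENNReal.tsum_mul_right]
    rw [ENNReal.tsum_comm]
    refine ENNReal.tsum_le_of_sum_range_le fun n => ?_
    cases n with
    | zero => simp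
    | succ n =>
      have := hone.sum_halt_add_go_le (halt := fun k => ⟨_, hhalt k⟩) h0'
        (fun k => ⟨Θ k, hL k, h1' k⟩) hgoT n
      simp only [mul_one, tsum_pushW] at this
      exact (le_self_add.trans this).trans (SubDist.point _).tsum_le_one
  refine ⟨⟨pushW f w Δ', hbound⟩, ⟨Δ, fun k => ⟨_, hhalt k⟩, h0',
    fun k => ⟨Θ k, hL k, h1' k⟩, hgoT, fun y => ?_⟩, fun _ => rfl⟩
  change pushW f w Δ' y = ∑' k, pushW f w (halt k) y
  rw [← pushW_tsum]
  congr 1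
  exact funext h3

/-! ### Constructing extreme derivations -/

namespace TestingStructure

variable {P : TestingStructure S}

theorem tsum_weighted_comm (q : S → ℝ≥0∞) (π : S → PMF S) :
    ∑' x, ∑' s, q s * π s x = ∑' s, q s := by
  rw [ENNReal.tsum_comm]
  simp_rw [ENNReal.tsum_mul_left, PMF.tsum_coe, mul_one]

/-- One step of the policy `π`. -/
def policyStep (π : S → PMF S) (Δ : SubDist S) : SubDist S :=
  ⟨fun x => ∑' s, Δ s * π s x, by rw [tsum_weighted_comm]; exact Δ.tsum_le_one⟩

/-- A finitely supported sub-distribution is a finite combination of points, which is the only kind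
of combination that `Lift` admits. -/
theorem lift_policyStep {R : S → PMF S → Prop} (π : S → PMF S) {Δ : SubDist S}
    (hfin : (Function.support Δ).Finite) (hR : ∀ s, Δ s ≠ 0 → R s (π s)) :
    Lift (toSub R) Δ (policyStep π Δ) := by
  classical
  have hsum : ∀ g : S → ℝ≥0∞, ∑' s, Δ s * g s = ∑ i : hfin.toFinset, Δ i * g i := by
    intro g
    rw [tsum_eq_sum (s := hfin.toFinset) fun s hs => by
      rw [Set.Finite.mem_toFinset, Function.notMem_support] at hs; rw [hs, zero_mul]]
    exact (Finset.sum_coe_sort hfin.toFinset fun s => Δ s * g s).symm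
  refine Lift.comb (fun i : hfin.toFinset => Δ i) (fun i => SubDist.point (i : S))
    (fun i => SubDist.ofPMF (π i)) ?_ (fun i => Lift.point _ _ ⟨_, hR _ ?_, rfl⟩)
    (fun s => ?_) (fun t => hsum fun s => π s t)
  · have := hsum fun _ => 1
    simp only [mul_one] at this
    rw [← this]
    exact Δ.tsum_le_one
  · simpa using (Set.Finite.mem_toFinset hfin).1 i.2
  · rw [← hsum fun x => SubDist.point x s]
    rw [tsum_eq_single s fun x hx => by rw [SubDist.point_of_ne hx.symm, mul_zero],
      SubDist.point_self, mul_one]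

variable (P) in
/-- The reductions have finite supports. -/
def FiniteSupport : Prop := ∀ s μ, P.red s μ → μ.support.Finite

/-- Every state has an extreme derivative if the reductions have finite supports. -/
theorem exists_extremeDer (hP : P.FiniteSupport) (s₀ : S) :
    ∃ Δ', P.ExtremeDer (SubDist.point s₀) Δ' := by
  classical
  -- The states at which an extreme derivation may stop. The policy stops exactly there and takes a
  -- fixed reduction everywhere else.
  let stuck : S → Prop := fun s => (∃ μ, P.red s μ) → P.success s
  have hπ : ∀ s, ∃ μ : PMF S, μ.support.Finite ∧ (¬ stuck s → P.red s μ) := by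
    intro s
    by_cases h : ∃ μ, P.red s μ
    · obtain ⟨μ, hμ⟩ := h
      exact ⟨μ, hP _ _ hμ, fun _ => hμ⟩
    · exact ⟨PMF.pure s, by simp, fun hs => absurd (fun h' => absurd h' h) hs⟩
  choose π hfin hred using hπ
  let mid : ℕ → SubDist S := fun k =>
    Nat.rec (SubDist.point s₀) (fun _ Δ => policyStep π (Δ.restrict fun s => ¬ stuck s)) k
  let go : ℕ → SubDist S := fun k => (mid k).restrict fun s => ¬ stuck s
  let halt : ℕ → SubDist S := fun k => (mid k).restrict stuck
  have hsplit : ∀ k s, mid k s = go k s + halt k s := by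
    intro k s
    by_cases h : stuck s <;> simp [go, halt, SubDist.restrict, h]
  have hgo : ∀ k s, go k s ≠ 0 → ¬ stuck s ∧ mid k s ≠ 0 := by
    intro k s h
    have hs : ¬ stuck s := fun hs => h (Set.indicator_of_notMem (fun h' : ¬ stuck s => h' hs) _)
    exact ⟨hs, fun h' => h ((Set.indicator_of_mem (s := {s | ¬ stuck s}) hs _).trans h')⟩
  have hhalt : ∀ k s, halt k s ≠ 0 → stuck s := by
    intro k s h
    by_contra hs
    simp [halt, SubDist.restrict, hs] at h
  have hmid : ∀ k, (Function.support (mid k)).Finite := by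
    intro k
    induction k with
    | zero =>
      refine (Set.finite_singleton s₀).subset fun s hs => ?_
      by_contra h
      exact hs (SubDist.point_of_ne h)
    | succ k ih =>
      refine (ih.biUnion fun s _ => hfin s).subset fun x hx => ?_
      have : ∑' s, go k s * π s x ≠ 0 := hx
      obtain ⟨s, hs⟩ : ∃ s, go k s * π s x ≠ 0 := by
        by_contra hc
        push Not at hc
        exact this (ENNReal.tsum_eq_zero.2 hc)
      exact Set.mem_biUnion (x := s) (hgo k s (left_ne_zero_of_mul hs)).2
        (right_ne_zero_of_mul hs)
  have hstep : ∀ k, Lift (toSub P.red) (go k) (mid (k + 1)) := fun k =>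
    lift_policyStep π ((hmid k).subset fun s hs => (hgo k s hs).2)
      fun s hs => hred s (hgo k s hs).1
  have hbound : ∑' s, ∑' k, halt k s ≤ 1 := by
    rw [ENNReal.tsum_comm]
    refine ENNReal.tsum_le_of_sum_range_le fun n => ?_
    have hm : ∀ k, ∑' s, mid (k + 1) s = ∑' s, go k s := fun k => tsum_weighted_comm (go k) π
    -- Policy steps preserve mass, so what has halted and what is still present add up to at most
    -- the initial mass.
    have : ∀ k, ∑ j ∈ Finset.range k, (∑' s, halt j s) + ∑' s, mid k s ≤ 1 := by
      intro k
      induction k with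
      | zero => simpa using (mid 0).tsum_le_one
      | succ k ih =>
        rw [Finset.sum_range_succ, hm, add_assoc, ← ENNReal.tsum_add]
        simp_rw [add_comm (halt k _), ← hsplit]
        exact ih
    exact le_self_add.trans (this n)
  refine ⟨⟨fun s => ∑' k, halt k s, hbound⟩, ⟨go, halt, hsplit 0,
    fun k => ⟨mid (k + 1), hstep k, hsplit (k + 1)⟩, fun k s h hs => (hgo k s h).1 fun _ => hs,
    fun _ => rfl⟩, fun s hs => ?_⟩
  obtain ⟨k, hk⟩ : ∃ k, halt k s ≠ 0 := by
    by_contra hc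
    push Not at hc
    exact hs (ENNReal.tsum_eq_zero.2 hc)
  exact hhalt k s hk

theorem ExtremeDer.comb {ι : Type*} [Fintype ι] (p : ι → ℝ≥0∞) (hp : ∑ i, p i ≤ 1)
    {Δs Θs : ι → SubDist S} (h : ∀ i, P.ExtremeDer (Δs i) (Θs i)) :
    P.ExtremeDer (SubDist.comb p hp Δs) (SubDist.comb p hp Θs) := by
  have h' := fun i => (h i).1
  choose go halt h0 h1 h2 h3 using h'
  choose mid hm hm' using h1
  refine ⟨⟨fun k => SubDist.comb p hp fun i => go i k, fun k => SubDist.comb p hp fun i => halt i k,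
    fun s => ?_, fun k => ⟨SubDist.comb p hp fun i => mid i k,
      Lift.comb p _ _ hp (fun i => hm i k) (fun _ => rfl) fun _ => rfl, fun s => ?_⟩,
    fun k s hs => ?_, fun s => ?_⟩, fun s hs => ?_⟩
  · simp [SubDist.comb, h0, mul_add, Finset.sum_add_distrib]
  · simp [SubDist.comb, hm', mul_add, Finset.sum_add_distrib]
  · obtain ⟨i, -, hi⟩ := Finset.exists_ne_zero_of_sum_ne_zero hs
    exact h2 i k s (right_ne_zero_of_mul hi)
  · simp only [SubDist.comb, h3]
    rw [Summable.tsum_finsetSum fun _ _ => ENNReal.summable]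
    simp_rw [ENNReal.tsum_mul_left]
  · obtain ⟨i, -, hi⟩ := Finset.exists_ne_zero_of_sum_ne_zero hs
    exact (h i).2 s (right_ne_zero_of_mul hi)

/-- The sequences are shifted by one: at stage 0 all of `Δ` proceeds and nothing halts. -/
theorem HyperDer.prepend {Δ Θ Δ' : SubDist S} (hs : ∀ s, Δ s ≠ 0 → ¬ P.success s)
    (hL : Lift (toSub P.red) Δ Θ) (h : P.HyperDer Θ Δ') : P.HyperDer Δ Δ' := by
  obtain ⟨go, halt, h0, h1, h2, h3⟩ := h
  refine ⟨fun k => Nat.casesOn k Δ go, fun k => Nat.casesOn k SubDist.zero halt,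
    fun s => by simp [SubDist.zero], fun k => ?_, fun k => ?_, fun s => ?_⟩
  · cases k with
    | zero => exact ⟨Θ, hL, h0⟩
    | succ k => exact h1 k
  · cases k with
    | zero => exact hs
    | succ k => exact h2 k
  · rw [h3, tsum_eq_zero_add' (f := fun k => (Nat.casesOn k SubDist.zero halt : SubDist S) s)
      ENNReal.summable]
    exact (zero_add _).symm

theorem HyperDer.refl (Δ : SubDist S) : P.HyperDer Δ Δ := by
  refine ⟨fun _ => SubDist.zero, fun k => Nat.casesOn k Δ fun _ => SubDist.zero, fun x => ?_,
    fun k => ?_, fun k x hx => absurd rfl hx, fun x => ?_⟩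
  · simp [SubDist.zero]
  -- The zero sub-distribution steps to itself as the empty combination.
  · exact ⟨SubDist.zero, Lift.comb (ι := Empty) (fun _ => 0) (fun _ => SubDist.zero)
      (fun _ => SubDist.zero) (by simp) (by simp) (by simp [SubDist.zero])
      (by simp [SubDist.zero]), by simp [SubDist.zero]⟩
  · rw [tsum_eq_zero_add' ENNReal.summable]
    simp [SubDist.zero]

theorem hyperDer_point_of_red {s : S} {μ : PMF S} (hs : ¬ P.success s) (h : P.red s μ) :
    P.HyperDer (SubDist.point s) (SubDist.ofPMF μ) := by
  refine .prepend (fun x hx => ?_) (Lift.point s _ ⟨μ, h, rfl⟩) (.refl _)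
  obtain rfl : x = s := by
    by_contra hc
    exact hx (SubDist.point_of_ne hc)
  exact hs

-- Lower bounds on attainable results.

variable (P) in
/-- Some result from the state `s` is at least `r`. -/
def Attains (s : S) (r : ℝ≥0∞) : Prop := ∃ q ∈ P.results (SubDist.ofPMF (PMF.pure s)), r ≤ q

theorem Attains.mono {s : S} {r r' : ℝ≥0∞} (h : P.Attains s r) (hr : r' ≤ r) :
    P.Attains s r' := h.imp fun _ hq => ⟨hq.1, hr.trans hq.2⟩

theorem attains_zero (hP : P.FiniteSupport) (s : S) : P.Attains s 0 := by
  obtain ⟨Δ', h⟩ := exists_extremeDer hP s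
  exact ⟨_, ⟨Δ', h, rfl⟩, zero_le⟩

theorem value_point {s : S} (h : P.success s) : P.value (SubDist.point s) = 1 := by
  classical
  unfold value
  rw [tsum_eq_single s fun x hx => by rw [SubDist.point_of_ne hx, ite_self], if_pos h,
    SubDist.point_self]

theorem attains_one {s : S} (h : P.success s) : P.Attains s 1 := by
  refine ⟨_, ⟨SubDist.point s, ⟨.refl _, fun x hx _ => ?_⟩, rfl⟩, (value_point h).ge⟩
  by_contra hc
  exact hx (SubDist.point_of_ne fun h' => hc (h' ▸ h))

theorem value_comb {ι : Type*} [Fintype ι] (p : ι → ℝ≥0∞) (hp : ∑ i, p i ≤ 1)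
    (Δs : ι → SubDist S) : P.value (SubDist.comb p hp Δs) = ∑ i, p i * P.value (Δs i) := by
  classical
  have := tsum_comb_mul p (fun i => Δs i) fun x => if P.success x then 1 else 0
  simpa [mul_ite, value, SubDist.comb] using this

/-- An unsuccessful state attains the averages of what the results of a reduction attain. -/
theorem Attains.of_red {s : S} {μ : PMF S} (hs : ¬ P.success s) (hμ : P.red s μ)
    (hfin : μ.support.Finite) {f : S → ℝ≥0∞} (h : ∀ x, μ x ≠ 0 → P.Attains x (f x)) :
    P.Attains s (∑' x, μ x * f x) := by
  classical
  have hsum : ∀ g : S → ℝ≥0∞, ∑' x, μ x * g x = ∑ i : hfin.toFinset, μ i * g i := by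
    intro g
    rw [tsum_eq_sum (s := hfin.toFinset) fun s hs => by
      rw [Set.Finite.mem_toFinset, PMF.mem_support_iff, not_not] at hs; rw [hs, zero_mul]]
    exact (Finset.sum_coe_sort hfin.toFinset fun s => μ s * g s).symm
  have hmem : ∀ i : hfin.toFinset, P.Attains i (f i) := fun i =>
    h i ((Set.Finite.mem_toFinset hfin).1 i.2)
  choose q hq hfq using hmem
  choose Δ' hΔ hqΔ using hq
  have hp : ∑ i : hfin.toFinset, μ i ≤ 1 := by
    have := hsum fun _ => 1
    simp only [mul_one, μ.tsum_coe] at this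
    exact this.ge
  -- Extreme derivatives chosen separately for the finitely many states of `μ` are averaged with the
  -- weights of `μ`.
  have hD : P.ExtremeDer (SubDist.ofPMF μ)
      (SubDist.comb (fun i : hfin.toFinset => μ i) hp Δ') := by
    have he : SubDist.ofPMF μ = SubDist.comb (fun i : hfin.toFinset => μ i) hp
        fun i => SubDist.point (i : S) := by
      refine SubDist.ext' fun x => ?_
      change μ x = ∑ i : hfin.toFinset, μ i * SubDist.point (i : S) x
      rw [← hsum fun y => SubDist.point y x,
        tsum_eq_single x fun y hy => by rw [SubDist.point_of_ne hy.symm, mul_zero],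
        SubDist.point_self, mul_one]
    rw [he]
    exact ExtremeDer.comb _ hp hΔ
  refine ⟨_, ⟨_, ⟨.prepend (fun x hx => ?_) (Lift.point s _ ⟨μ, hμ, rfl⟩) hD.1, hD.2⟩, rfl⟩, ?_⟩
  · obtain rfl : x = s := by
      by_contra hc
      exact hx (SubDist.point_of_ne hc)
    exact hs
  · rw [value_comb, hsum]
    gcongr with i
    rw [← hqΔ]
    exact hfq i

theorem Attains.of_red_const {s : S} {μ : PMF S} (hs : ¬ P.success s) (hμ : P.red s μ)
    (hfin : μ.support.Finite) {r : ℝ≥0∞} (h : ∀ x, μ x ≠ 0 → P.Attains x r) : P.Attains s r := by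
  have := Attains.of_red hs hμ hfin (f := fun _ => r) h
  rwa [ENNReal.tsum_mul_right, μ.tsum_coe, one_mul] at this

theorem value_le_one (Δ : SubDist S) : P.value Δ ≤ 1 := by
  classical
  refine le_trans (ENNReal.tsum_le_tsum fun s => ?_) Δ.tsum_le_one
  split_ifs <;> simp

/-- A sub-distribution of value one is supported on successful states. -/
theorem success_of_one_le_value {Δ : SubDist S} (h : 1 ≤ P.value Δ) {s : S} (hs : Δ s ≠ 0) :
    P.success s := by
  classical
  by_contra hc
  -- The mass of an unsuccessful state is not counted in the value, so both fit into the total mass.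
  have h1 : P.value Δ + Δ s ≤ 1 := by
    refine le_trans ?_ Δ.tsum_le_one
    rw [← tsum_ite_eq s fun _ => Δ s]
    unfold value
    rw [← ENNReal.tsum_add]
    refine ENNReal.tsum_le_tsum fun x => ?_
    by_cases hx : x = s
    · subst hx; simp [hc]
    · simp only [hx, if_false, add_zero]; split_ifs <;> simp
  have h2 : 1 + Δ s ≤ 1 + 0 := by
    rw [add_zero]
    exact (add_le_add_left h _).trans h1
  exact hs (le_antisymm ((ENNReal.add_le_add_iff_left ENNReal.one_ne_top).1 h2) (zero_le))

end TestingStructure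

end Probability

section Semantics

variable {Node Ch Val : Type u}

/-! ### Success -/

/-- The success clause is enabled in a state. -/
inductive HasOmega : State Ch Val 0 → Prop
  | omega : HasOmega .omega
  | addL (s t : State Ch Val 0) : HasOmega s → HasOmega (.add s t)
  | addR (s t : State Ch Val 0) : HasOmega t → HasOmega (.add s t)
  | iteTrue (b : BExpr Val 0) (s t : State Ch Val 0) :
      BExpr.eval b = true → HasOmega s → HasOmega (.ite b s t)
  | iteFalse (b : BExpr Val 0) (s t : State Ch Val 0) :
      BExpr.eval b = false → HasOmega t → HasOmega (.ite b s t)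
  | call (A : Name Ch Val) (es : Fin A.arity → Expr Val 0) :
      HasOmega (A.body.subst es) → HasOmega (.call A es)

theorem hasOmega_add {s t : State Ch Val 0} :
    HasOmega (.add s t) ↔ HasOmega s ∨ HasOmega t :=
  ⟨fun h => by cases h with
    | addL _ _ h => exact .inl h
    | addR _ _ h => exact .inr h, fun h => h.elim (.addL _ _) (.addR _ _)⟩

theorem hasOmega_call {A : Name Ch Val} {es : Fin A.arity → Expr Val 0} :
    HasOmega (.call A es) ↔ HasOmega (A.body.subst es) :=
  ⟨fun h => by cases h; assumption, .call _ _⟩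

theorem hasOmega_ite {b : BExpr Val 0} {s t : State Ch Val 0} :
    HasOmega (.ite b s t) ↔ HasOmega (if BExpr.eval b = true then s else t) := by
  constructor
  · intro h
    cases h with
    | iteTrue _ _ _ hb h => rwa [if_pos hb]
    | iteFalse _ _ _ hb h => rwa [if_neg (by simp [hb])]
  · intro h
    split_ifs at h with hb
    · exact .iteTrue _ _ _ hb h
    · exact .iteFalse _ _ _ (by simpa using hb) h

theorem not_hasOmega_nil : ¬ HasOmega (.nil : State Ch Val 0) := nofun

theorem not_hasOmega_tau (P : ProcTerm Ch Val 0) : ¬ HasOmega (.tau P : State Ch Val 0) := nofun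

theorem not_hasOmega_snd (c : Ch) (e : Expr Val 0) (P : ProcTerm Ch Val 0) :
    ¬ HasOmega (.snd c e P : State Ch Val 0) := nofun

/-- Gives a structural criterion for failure of success, which the existential definition by
congruence does not provide directly. -/
theorem StEquiv.hasOmega_iff {s t : State Ch Val 0} (h : StEquiv s t) :
    HasOmega s ↔ HasOmega t := by
  induction h with
  | refl => rfl
  | symm _ _ _ ih => exact ih.symm
  | trans _ _ _ _ _ ih₁ ih₂ => exact ih₁.trans ih₂
  | congr _ _ _ _ _ _ ih₁ ih₂ => rw [hasOmega_add, hasOmega_add, ih₁, ih₂]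
  | comm => rw [hasOmega_add, hasOmega_add, or_comm]
  | assoc => simp only [hasOmega_add, or_assoc]
  | nil => simp [hasOmega_add, not_hasOmega_nil]
  | iteTrue b s t hb => rw [hasOmega_ite, if_pos hb]
  | iteFalse b s t hb => rw [hasOmega_ite, if_neg (by simp [hb])]
  | call => exact hasOmega_call

theorem HasOmega.exists_equiv {s : State Ch Val 0} (h : HasOmega s) :
    ∃ t, StEquiv s (.add .omega t) := by
  induction h with
  | omega => exact ⟨.nil, .symm _ _ (.nil _)⟩
  | addL s t _ ih =>
    obtain ⟨s', h⟩ := ih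
    exact ⟨_, .trans _ _ _ (.congr _ _ _ _ h (.refl t)) (.assoc _ _ _)⟩
  | addR s t _ ih =>
    obtain ⟨s', h⟩ := ih
    exact ⟨_, .trans _ _ _ (.comm _ _)
      (.trans _ _ _ (.congr _ _ _ _ h (.refl s)) (.assoc _ _ _))⟩
  | iteTrue b s t hb _ ih => exact ih.imp fun _ h => .trans _ _ _ (.iteTrue _ _ _ hb) h
  | iteFalse b s t hb _ ih => exact ih.imp fun _ h => .trans _ _ _ (.iteFalse _ _ _ hb) h
  | call A es _ ih => exact ih.imp fun _ h => .trans _ _ _ (.call _ _) h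

/-- The success clause is enabled at some node. -/
def Sys.HasOmega : Sys Node Ch Val → Prop
  | .nil => False
  | .node s _ => WNet.HasOmega s
  | .par M N => M.HasOmega ∨ N.HasOmega

theorem SysEquiv.hasOmega_iff {M N : Sys Node Ch Val} (h : SysEquiv M N) :
    M.HasOmega ↔ N.HasOmega := by
  induction h with
  | refl => rfl
  | symm _ _ _ ih => exact ih.symm
  | trans _ _ _ _ _ ih₁ ih₂ => exact ih₁.trans ih₂
  | congr _ _ _ _ _ _ ih₁ ih₂ => exact or_congr ih₁ ih₂
  | comm => exact or_comm
  | assoc => exact or_assoc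
  | nil => exact iff_of_eq (or_false _)
  | node _ _ _ h => exact h.hasOmega_iff

theorem Sys.success_iff {M : Sys Node Ch Val} : M.Success ↔ M.HasOmega := by
  constructor
  · rintro ⟨M', s, n, h⟩
    exact h.hasOmega_iff.2 (.inr (.addL _ _ .omega))
  · intro h
    induction M with
    | nil => exact h.elim
    | node s n =>
      obtain ⟨t, ht⟩ := WNet.HasOmega.exists_equiv h
      exact ⟨.nil, t, n, .trans _ _ _ (.node _ _ n ht)
        (.trans _ _ _ (.symm _ _ (.nil _)) (.comm _ _))⟩
    | par M N ihM ihN =>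
      rcases h with h | h
      · obtain ⟨M', s, n, e⟩ := ihM h
        exact ⟨.par N M', s, n, .trans _ _ _ (.comm _ _)
          (.trans _ _ _ (.congr _ _ _ _ (.refl N) e) (.symm _ _ (.assoc _ _ _)))⟩
      · obtain ⟨N', s, n, e⟩ := ihN h
        exact ⟨.par M N', s, n,
          .trans _ _ _ (.congr _ _ _ _ (.refl M) e) (.symm _ _ (.assoc _ _ _))⟩

/-! ### Transitions -/

/-- Only an inclusion, since one branch disappears when `p` is 0 or 1. -/
theorem mix_support_subset {S : Type*} (p : unitInterval) (μ ν : PMF S) :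
    (mix p μ ν).support ⊆ μ.support ∪ ν.support := by
  intro s hs
  by_contra hc
  rw [Set.mem_union, not_or, PMF.mem_support_iff, PMF.mem_support_iff, not_not, not_not] at hc
  refine hs ?_
  change ENNReal.ofReal p * μ s + ENNReal.ofReal (1 - p) * ν s = 0
  rw [hc.1, hc.2, mul_zero, mul_zero, add_zero]

theorem Proc.finite_support_interp : {k : ℕ} → (P : ProcTerm Ch Val k) →
    P.interp.support.Finite
  | _, .state s => by simp [Proc.interp]
  | _, .choice p P Q => by
    rw [Proc.interp]
    exact (P.finite_support_interp.union Q.finite_support_interp).subset (mix_support_subset _ _ _)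

theorem StStep.finite_support {s : State Ch Val 0} {α : StAct Ch Val}
    {Δ : PMF (State Ch Val 0)} (h : StStep s α Δ) : Δ.support.Finite := by
  induction h with
  | snd | rcv | tau => exact Proc.finite_support_interp _
  | _ => assumption

theorem finite_support_map {S T : Type*} {μ : PMF S} (f : S → T) (h : μ.support.Finite) :
    (μ.map f).support.Finite := by
  rw [PMF.support_map]
  exact h.image f

theorem finite_support_parDist {Δ Θ : PMF (Sys Node Ch Val)} (hΔ : Δ.support.Finite)
    (hΘ : Θ.support.Finite) : (parDist Δ Θ).support.Finite := by
  rw [parDist, PMF.support_bind]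
  exact hΔ.biUnion fun _ _ => finite_support_map _ hΘ

theorem finite_support_pure {S : Type*} (s : S) : (PMF.pure s).support.Finite := by simp

theorem SysStep.finite_support {Γ : Graph Node} {M : Sys Node Ch Val} {α : SysAct Node Ch Val}
    {Δ : PMF (Sys Node Ch Val)} (h : SysStep Γ M α Δ) : Δ.support.Finite := by
  induction h with
  | broad _ _ _ _ _ h => exact finite_support_map _ h.finite_support
  | recv _ _ _ _ _ _ h => exact finite_support_map _ h.finite_support
  | tau _ _ _ h => exact finite_support_map _ h.finite_support
  | deaf | disc | nil => exact finite_support_pure _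
  | tauL _ _ _ _ _ ih => exact finite_support_parDist ih (finite_support_pure _)
  | tauR _ _ _ _ _ ih => exact finite_support_parDist (finite_support_pure _) ih
  | prop _ _ _ _ _ _ _ _ _ ih₁ ih₂ => exact finite_support_parDist ih₁ ih₂
  | syncL _ _ _ _ _ _ _ _ _ ih₁ ih₂ => exact finite_support_parDist ih₁ ih₂
  | syncR _ _ _ _ _ _ _ _ _ ih₁ ih₂ => exact finite_support_parDist ih₁ ih₂

theorem netTS_finiteSupport : (netTS Node Ch Val).FiniteSupport := by
  rintro M _ ⟨Δ, rfl, ⟨_, _, h⟩ | ⟨_, _, _, h⟩⟩ <;> exact finite_support_map _ h.finite_support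

/-- Every system can react to every broadcast. -/
theorem SysStep.exists_rcv (Γ : Graph Node) (M : Sys Node Ch Val) (m : Node) (c : Ch) (v : Val) :
    ∃ Δ, SysStep Γ M (.rcv m c v) Δ := by
  induction M with
  | nil => exact ⟨_, .nil m c v⟩
  | node s n =>
    by_cases h : Γ.conn m n
    · by_cases hs : ∃ Δ, StStep s (.rcv c v) Δ
      · obtain ⟨Δ, hs⟩ := hs
        exact ⟨_, .recv _ _ _ _ _ _ hs h⟩
      · exact ⟨_, .deaf _ _ _ _ _ hs⟩
    · exact ⟨_, .disc _ _ _ _ _ h⟩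
  | par M N ihM ihN =>
    obtain ⟨Δ, hΔ⟩ := ihM
    obtain ⟨Θ, hΘ⟩ := ihN
    exact ⟨_, .prop _ _ _ _ _ _ _ hΔ hΘ⟩

theorem parDist_pure_left (M : Sys Node Ch Val) (Δ : PMF (Sys Node Ch Val)) :
    parDist (PMF.pure M) Δ = Δ.map (.par M) := by
  rw [parDist, PMF.pure_bind]

theorem parDist_pure_right (Δ : PMF (Sys Node Ch Val)) (N : Sys Node Ch Val) :
    parDist Δ (PMF.pure N) = Δ.map fun M => .par M N := by
  simp only [parDist, PMF.pure_map]
  rfl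

theorem nodeDist_pure (s : State Ch Val 0) (n : Node) :
    nodeDist (PMF.pure s) n = PMF.pure (.node s n) := PMF.pure_map _ _

theorem netDist_pure (Γ : Graph Node) (M : Sys Node Ch Val) :
    netDist Γ (PMF.pure M) = PMF.pure ⟨Γ, M⟩ := PMF.pure_map _ _

theorem mem_nodes_of_tau {Γ : Graph Node} {M : Sys Node Ch Val} {n : Node}
    {Δ : PMF (Sys Node Ch Val)} (h : SysStep Γ M (.tau n) Δ) : n ∈ M.nodes := by
  generalize hα : SysAct.tau n = α at h
  induction h with
  | tau s m =>
    cases hα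
    exact List.mem_singleton.2 rfl
  | tauL M N m Δ _ ih =>
    cases hα
    exact List.mem_append_left _ (ih rfl)
  | tauR M N m Δ _ ih =>
    cases hα
    exact List.mem_append_right _ (ih rfl)
  | _ => cases hα

/-! ### Networks with a distinguished node -/

/-- The network of the node `m` with code `s` and the system `t`. -/
def nodeWith (Γ : Graph Node) (m : Node) (s : State Ch Val 0) (t : Sys Node Ch Val) :
    Net Node Ch Val := ⟨Γ, .par (.node s m) t⟩

theorem nodeWith_inj {Γ : Graph Node} {m : Node} {s s' : State Ch Val 0}
    {t t' : Sys Node Ch Val} (h : nodeWith Γ m s t = nodeWith Γ m s' t') : s = s' ∧ t = t' := by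
  simpa [nodeWith] using h

theorem nodeWith_success {Γ : Graph Node} {m : Node} {s : State Ch Val 0}
    {t : Sys Node Ch Val} : (netTS Node Ch Val).success (nodeWith Γ m s t) ↔
      HasOmega s ∨ t.HasOmega := Sys.success_iff

/-- The internal moves and broadcasts of a system. -/
def SysRed (Γ : Graph Node) (t : Sys Node Ch Val) (Θ : PMF (Sys Node Ch Val)) : Prop :=
  (∃ n, SysStep Γ t (.tau n) Θ) ∨ ∃ n c v, SysStep Γ t (.snd n c v) Θ

/-- A state that does not receive. -/
def Deaf (s : State Ch Val 0) : Prop := ∀ c v Δ, ¬ StStep s (.rcv c v) Δ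

theorem Deaf.rcv {s : State Ch Val 0} (hs : Deaf s) (Γ : Graph Node) (m n : Node) (c : Ch)
    (v : Val) : SysStep Γ (.node s m) (.rcv n c v) (PMF.pure (.node s m)) :=
  .deaf _ _ _ _ _ fun ⟨_, h⟩ => hs _ _ _ h

theorem Deaf.eq_pure {s : State Ch Val 0} (hs : Deaf s) {Γ : Graph Node} {m n : Node} {c : Ch}
    {v : Val} {Δ : PMF (Sys Node Ch Val)} (h : SysStep Γ (.node s m) (.rcv n c v) Δ) :
    Δ = PMF.pure (.node s m) := by
  cases h with
  | recv _ _ _ _ _ _ h => exact absurd h (hs _ _ _)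
  | deaf => rfl
  | disc => rfl

theorem netDist_parDist_right (Γ : Graph Node) (m : Node) (s : State Ch Val 0)
    (Θ : PMF (Sys Node Ch Val)) :
    netDist Γ (parDist (PMF.pure (.node s m)) Θ) = Θ.map (nodeWith Γ m s) := by
  rw [parDist_pure_left, netDist, PMF.map_comp]
  rfl

theorem netDist_parDist_left (Γ : Graph Node) (m : Node) (Δ : PMF (State Ch Val 0))
    (t : Sys Node Ch Val) :
    netDist Γ (parDist (nodeDist Δ m) (PMF.pure t)) = Δ.map fun s => nodeWith Γ m s t := by
  rw [parDist_pure_right, netDist, nodeDist, PMF.map_comp, PMF.map_comp]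
  rfl

theorem nodeWith_red_tau {Γ : Graph Node} {m : Node} {s : State Ch Val 0}
    {Δ : PMF (State Ch Val 0)} (h : StStep s .tau Δ) (t : Sys Node Ch Val) :
    Net.Red (nodeWith Γ m s t) (Δ.map fun s => nodeWith Γ m s t) :=
  ⟨_, (netDist_parDist_left Γ m Δ t).symm, .inl ⟨m,
    List.mem_append_left _ (List.mem_singleton.2 rfl),
    .tauL _ _ _ _ (.tau _ _ _ h)⟩⟩

/-- A broadcast of `t` leaves a deaf node unchanged, so the moves of the context do not depend on
which deaf code runs at `m`. This is what allows `flip` to be replaced by `wait`. -/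
theorem nodeWith_red_right {Γ : Graph Node} {m : Node} {s : State Ch Val 0} (hs : Deaf s)
    {t : Sys Node Ch Val} {Θ : PMF (Sys Node Ch Val)} (h : SysRed Γ t Θ) :
    Net.Red (nodeWith Γ m s t) (Θ.map (nodeWith Γ m s)) := by
  refine ⟨_, (netDist_parDist_right Γ m s Θ).symm, ?_⟩
  rcases h with ⟨n, h⟩ | ⟨n, c, v, h⟩
  · exact .inl ⟨n, List.mem_append_right _ (mem_nodes_of_tau h), .tauR _ _ _ _ h⟩
  · exact .inr ⟨n, c, v, .syncR _ _ _ _ _ _ _ (hs.rcv _ _ _ _ _) h⟩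

theorem nodeWith_red_cases {Γ : Graph Node} {m : Node} {s : State Ch Val 0} (hs : Deaf s)
    {t : Sys Node Ch Val} {D : PMF (Net Node Ch Val)} (h : Net.Red (nodeWith Γ m s t) D) :
    (∃ Δ, StStep s .tau Δ ∧ D = Δ.map fun s => nodeWith Γ m s t) ∨
    (∃ c v Δ Θ, StStep s (.snd c v) Δ ∧ SysStep Γ t (.rcv m c v) Θ ∧
      D = netDist Γ (parDist (nodeDist Δ m) Θ)) ∨
    ∃ Θ, SysRed Γ t Θ ∧ D = Θ.map (nodeWith Γ m s) := by
  obtain ⟨Ξ, rfl, ⟨n, -, h⟩ | ⟨n, c, v, h⟩⟩ := h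
  · cases h with
    | tauL _ _ _ _ h =>
      cases h with
      | tau _ _ Δ h => exact .inl ⟨Δ, h, netDist_parDist_left Γ m Δ t⟩
    | tauR _ _ _ Θ h => exact .inr (.inr ⟨Θ, .inl ⟨_, h⟩, netDist_parDist_right Γ m s Θ⟩)
  · cases h with
    | syncL _ _ _ _ _ _ Θ h h' =>
      cases h with
      | broad _ _ _ _ Δ h => exact .inr (.inl ⟨c, v, Δ, Θ, h, h', rfl⟩)
    | syncR _ _ _ _ _ _ Θ h h' =>
      rw [hs.eq_pure h]
      exact .inr (.inr ⟨Θ, .inr ⟨_, _, _, h'⟩, netDist_parDist_right Γ m s Θ⟩)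

/-! ### Transitions of particular states -/

theorem stStep_call {A : Name Ch Val} {es : Fin A.arity → Expr Val 0} {α : StAct Ch Val}
    {Δ : PMF (State Ch Val 0)} : StStep (.call A es) α Δ ↔ StStep (A.body.subst es) α Δ :=
  ⟨fun h => by cases h; assumption, .call _ _ _ _⟩

theorem stStep_add {s t : State Ch Val 0} {α : StAct Ch Val} {Δ : PMF (State Ch Val 0)} :
    StStep (.add s t) α Δ ↔ StStep s α Δ ∨ StStep t α Δ :=
  ⟨fun h => by cases h with
    | sumL _ _ _ _ h => exact .inl h
    | sumR _ _ _ _ h => exact .inr h, fun h => h.elim (.sumL _ _ _ _) (.sumR _ _ _ _)⟩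

theorem stStep_tau {P : ProcTerm Ch Val 0} {α : StAct Ch Val} {Δ : PMF (State Ch Val 0)} :
    StStep (.tau P) α Δ ↔ α = .tau ∧ Δ = P.interp :=
  ⟨fun h => by cases h; exact ⟨rfl, rfl⟩, by rintro ⟨rfl, rfl⟩; exact .tau P⟩

theorem stStep_snd {c : Ch} {e : Expr Val 0} {P : ProcTerm Ch Val 0} {α : StAct Ch Val}
    {Δ : PMF (State Ch Val 0)} :
    StStep (.snd c e P) α Δ ↔ α = .snd c (Expr.eval e) ∧ Δ = P.interp :=
  ⟨fun h => by cases h; exact ⟨rfl, rfl⟩, by rintro ⟨rfl, rfl⟩; exact .snd c e P⟩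

theorem stStep_ite {b : BExpr Val 0} {s t : State Ch Val 0} {α : StAct Ch Val}
    {Δ : PMF (State Ch Val 0)} :
    StStep (.ite b s t) α Δ ↔ StStep (if BExpr.eval b = true then s else t) α Δ := by
  constructor
  · intro h
    cases h with
    | iteTrue _ _ _ _ _ hb h => rwa [if_pos hb]
    | iteFalse _ _ _ _ _ hb h => rwa [if_neg (by simp [hb])]
  · intro h
    split_ifs at h with hb
    · exact .iteTrue _ _ _ _ _ hb h
    · exact .iteFalse _ _ _ _ _ (by simpa using hb) h

theorem not_stStep_nil {α : StAct Ch Val} {Δ : PMF (State Ch Val 0)} :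
    ¬ StStep (.nil : State Ch Val 0) α Δ := nofun

theorem not_stStep_omega {α : StAct Ch Val} {Δ : PMF (State Ch Val 0)} :
    ¬ StStep (.omega : State Ch Val 0) α Δ := nofun

/-! ### Fair coins -/

/-- The distribution of a fair coin toss between `s` and `t`. -/
def coin {S : Type*} (s t : S) : PMF S :=
  mix ⟨1 / 2, by norm_num, by norm_num⟩ (PMF.pure s) (PMF.pure t)

theorem coin_apply {S : Type*} (s t x : S) :
    coin s t x = 2⁻¹ * SubDist.point s x + 2⁻¹ * SubDist.point t x := by
  have h : ENNReal.ofReal (1 / 2) = 2⁻¹ := by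
    rw [one_div, ENNReal.ofReal_inv_of_pos two_pos, ENNReal.ofReal_ofNat]
  change ENNReal.ofReal (1 / 2) * _ + ENNReal.ofReal (1 - 1 / 2) * _ = _
  rw [show (1 : ℝ) - 1 / 2 = 1 / 2 by norm_num, h]
  rfl

theorem tsum_coin_mul {S : Type*} (s t : S) (g : S → ℝ≥0∞) :
    ∑' x, coin s t x * g x = 2⁻¹ * g s + 2⁻¹ * g t := by
  simp_rw [coin_apply, add_mul, mul_assoc]
  rw [ENNReal.tsum_add, ENNReal.tsum_mul_left, ENNReal.tsum_mul_left, SubDist.tsum_point_mul,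
    SubDist.tsum_point_mul]

theorem coin_left_ne_zero {S : Type*} (s t : S) : coin s t s ≠ 0 := by
  simp [coin_apply, SubDist.point_self]

theorem coin_right_ne_zero {S : Type*} (s t : S) : coin s t t ≠ 0 := by
  simp [coin_apply, SubDist.point_self]

theorem eq_or_eq_of_coin_ne_zero {S : Type*} {s t x : S} (h : coin s t x ≠ 0) :
    x = s ∨ x = t := by
  by_contra hc
  rw [not_or] at hc
  exact h (by rw [coin_apply, SubDist.point_of_ne hc.1, SubDist.point_of_ne hc.2]; simp)

theorem tsum_map_mul {S T : Type*} (μ : PMF S) (f : S → T) (g : T → ℝ≥0∞) :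
    ∑' y, μ.map f y * g y = ∑' x, μ x * g (f x) := by
  classical
  simp_rw [PMF.map_apply, ← ENNReal.tsum_mul_right]
  rw [ENNReal.tsum_comm]
  refine tsum_congr fun x => ?_
  rw [tsum_eq_single (f x) fun y hy => by rw [if_neg hy, zero_mul], if_pos rfl]

theorem map_coin {S T : Type*} (f : S → T) (s t : S) :
    (coin s t).map f = coin (f s) (f t) := by
  classical
  ext y
  have := tsum_coin_mul s t fun x => if y = f x then 1 else 0
  simp only [mul_ite, mul_one, mul_zero] at this
  rw [PMF.map_apply, this, coin_apply]
  simp [SubDist.point, SubDist.ofPMF, PMF.pure_apply]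

/-- A weight that is constant along `g` only rescales. This covers the moves of the context, during
which the code of the distinguished node and hence the weight stay the same. -/
theorem pushW_map {A S T : Type*} (f : S → T) (w : S → ℝ≥0∞) (μ : PMF A) (g : A → S)
    {r : ℝ≥0∞} (hw : ∀ a, w (g a) = r) (y : T) :
    pushW f w (μ.map g) y = r * μ.map (f ∘ g) y := by
  classical
  have := tsum_map_mul μ g fun x => if f x = y then w x else 0
  simp only [mul_ite, mul_zero] at this
  rw [pushW, this, PMF.map_apply, ← ENNReal.tsum_mul_left]
  refine tsum_congr fun a => ?_
  rw [hw, mul_ite, mul_zero, mul_comm]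
  simp only [Function.comp_apply, eq_comm]

theorem pushW_coin {S T : Type*} (f : S → T) (w : S → ℝ≥0∞) (s t : S) (y : T) :
    pushW f w (coin s t) y =
      2⁻¹ * (w s * SubDist.point (f s) y) + 2⁻¹ * (w t * SubDist.point (f t) y) := by
  classical
  have := tsum_coin_mul s t fun x => if f x = y then w x else 0
  simp only [mul_ite, mul_zero] at this
  rw [pushW, this]
  simp [SubDist.point, SubDist.ofPMF, PMF.pure_apply, eq_comm]

end Semantics

-- The code of the witnesses: a counting gambler and a single coin toss.

section Witnesses

variable {Node Ch Val : Type u}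

/-- The counter operation on values that is induced by `f : ℕ → ℕ` and the encoding `e` of
numbers as values. -/
def onCounter (e : ℕ → Val) (f : ℕ → ℕ) (x : Val) : Val := e (f (Function.invFun e x))

theorem onCounter_apply {e : ℕ → Val} (he : e.Injective) (f : ℕ → ℕ) (n : ℕ) :
    onCounter e f (e n) = e (f n) := by
  rw [onCounter, Function.leftInverse_invFun he]

open Classical in
/-- The definitions `W(x) ⇐ τ.W(x) + c!x.C(x)`, `C(x) ⇐ τ.C(x+1) + τ.G(x)` and
`G(x) ⇐ if x = 0 then 0 else τ.(ω ½⊕ G(x-1))`. -/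
def defs (c : Ch) (e : ℕ → Val) : DefSys Ch Val where
  size := 3
  arity _ := 1
  body i := match i with
    | 0 => .add (.tau (.state (.call 0 fun _ ρ => ρ 0)))
        (.snd c (fun ρ => ρ 0) (.state (.call 1 fun _ ρ => ρ 0)))
    | 1 => .add (.tau (.state (.call 1 fun _ ρ => onCounter e (· + 1) (ρ 0))))
        (.tau (.state (.call 2 fun _ ρ => ρ 0)))
    | 2 => .ite (fun ρ => decide (ρ 0 = e 0)) .nil
        (.tau (.choice ⟨1 / 2, by norm_num, by norm_num⟩ (.state .omega)
          (.state (.call 2 fun _ ρ => onCounter e (· - 1) (ρ 0)))))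

/-- The state that waits and then starts to count with a broadcast. -/
def wait (c : Ch) (e : ℕ → Val) : State Ch Val 0 :=
  .call (⟨defs c e, (0 : Fin 3)⟩ : Name Ch Val) fun _ _ => e 0

/-- The state that increases the counter or starts to gamble. -/
def climb (c : Ch) (e : ℕ → Val) (n : ℕ) : State Ch Val 0 :=
  .call (⟨defs c e, (1 : Fin 3)⟩ : Name Ch Val) fun _ _ => e n

/-- The state that succeeds if one of `n` coin tosses does. -/
def gamble (c : Ch) (e : ℕ → Val) (n : ℕ) : State Ch Val 0 :=
  .call (⟨defs c e, (2 : Fin 3)⟩ : Name Ch Val) fun _ _ => e n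

/-- The state that tosses a coin once and then succeeds or terminates. -/
def flip : State Ch Val 0 :=
  .tau (.choice ⟨1 / 2, by norm_num, by norm_num⟩ (.state .omega) (.state .nil))

theorem wait_ne_gamble (c : Ch) (e : ℕ → Val) (n : ℕ) : wait c e ≠ gamble c e n := by
  intro h
  rw [wait, gamble, St.call.injEq] at h
  exact absurd (eq_of_heq (Sigma.mk.inj h.1).2) (show (0 : Fin 3) ≠ 2 by decide)

theorem climb_ne_gamble (c : Ch) (e : ℕ → Val) (n k : ℕ) : climb c e n ≠ gamble c e k := by
  intro h
  rw [climb, gamble, St.call.injEq] at h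
  exact absurd (eq_of_heq (Sigma.mk.inj h.1).2) (show (1 : Fin 3) ≠ 2 by decide)

theorem gamble_injective (c : Ch) {e : ℕ → Val} (he : e.Injective) :
    (gamble c e).Injective := by
  intro n k h
  rw [gamble, gamble, St.call.injEq] at h
  exact he (congrFun (congrFun (eq_of_heq h.2) (0 : Fin 1)) Fin.elim0)

theorem wait_ne_omega (c : Ch) (e : ℕ → Val) : wait c e ≠ .omega := nofun

theorem climb_ne_omega (c : Ch) (e : ℕ → Val) (n : ℕ) : climb c e n ≠ .omega := nofun

theorem gamble_ne_omega (c : Ch) (e : ℕ → Val) (n : ℕ) : gamble c e n ≠ .omega := nofun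

theorem body_wait (c : Ch) (e : ℕ → Val) :
    (Name.body (⟨defs c e, (0 : Fin 3)⟩ : Name Ch Val)).subst (fun _ _ => e 0) =
      (.add (.tau (.state (wait c e))) (.snd c (fun _ => e 0) (.state (climb c e 0))) :
        State Ch Val 0) := by
  rfl

/-- Injectivity of the encoding makes `onCounter` act on `e n` as the intended operation on `n`;
apart from that both sides agree by computation. -/
theorem body_climb (c : Ch) {e : ℕ → Val} (he : e.Injective) (n : ℕ) :
    (Name.body (⟨defs c e, (1 : Fin 3)⟩ : Name Ch Val)).subst (fun _ _ => e n) =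
      (.add (.tau (.state (climb c e (n + 1)))) (.tau (.state (gamble c e n))) :
        State Ch Val 0) := by
  unfold climb
  rw [← onCounter_apply he (· + 1)]
  rfl

open Classical in
theorem body_gamble (c : Ch) {e : ℕ → Val} (he : e.Injective) (n : ℕ) :
    (Name.body (⟨defs c e, (2 : Fin 3)⟩ : Name Ch Val)).subst (fun _ _ => e n) =
      (.ite (fun _ => decide (e n = e 0)) .nil
        (.tau (.choice ⟨1 / 2, by norm_num, by norm_num⟩ (.state .omega)
          (.state (gamble c e (n - 1))))) : State Ch Val 0) := by
  unfold gamble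
  rw [← onCounter_apply he (· - 1)]
  rfl

theorem stStep_wait {c : Ch} {e : ℕ → Val} {α : StAct Ch Val} {Δ : PMF (State Ch Val 0)} :
    StStep (wait c e) α Δ ↔ (α = .tau ∧ Δ = PMF.pure (wait c e)) ∨
      (α = .snd c (e 0) ∧ Δ = PMF.pure (climb c e 0)) := by
  rw [wait, stStep_call]
  erw [body_wait]
  rw [stStep_add, stStep_tau, stStep_snd]
  rfl

theorem stStep_climb {c : Ch} {e : ℕ → Val} (he : e.Injective) {n : ℕ} {α : StAct Ch Val}
    {Δ : PMF (State Ch Val 0)} :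
    StStep (climb c e n) α Δ ↔
      α = .tau ∧ (Δ = PMF.pure (climb c e (n + 1)) ∨ Δ = PMF.pure (gamble c e n)) := by
  rw [climb, stStep_call]
  erw [body_climb c he n]
  rw [stStep_add, stStep_tau, stStep_tau, and_or_left]
  rfl

theorem stStep_gamble {c : Ch} {e : ℕ → Val} (he : e.Injective) {n : ℕ} {α : StAct Ch Val}
    {Δ : PMF (State Ch Val 0)} :
    StStep (gamble c e n) α Δ ↔
      ∃ k, n = k + 1 ∧ α = .tau ∧ Δ = coin .omega (gamble c e k) := by
  rw [gamble, stStep_call]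
  erw [body_gamble c he n]
  rw [stStep_ite]
  cases n with
  | zero => simp [BExpr.eval, not_stStep_nil]
  | succ n =>
    rw [if_neg (by simp [BExpr.eval, he.eq_iff]), stStep_tau]
    exact ⟨fun h => ⟨n, rfl, h⟩, fun ⟨k, hk, h⟩ => by cases hk; exact h⟩

theorem stStep_flip {α : StAct Ch Val} {Δ : PMF (State Ch Val 0)} :
    StStep flip α Δ ↔ α = .tau ∧ Δ = coin .omega .nil := stStep_tau

theorem not_hasOmega_wait {c : Ch} {e : ℕ → Val} : ¬ HasOmega (wait c e) := by
  rw [wait, hasOmega_call]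
  erw [body_wait]
  simp [hasOmega_add, not_hasOmega_tau, not_hasOmega_snd]

theorem not_hasOmega_climb {c : Ch} {e : ℕ → Val} (he : e.Injective) (n : ℕ) :
    ¬ HasOmega (climb c e n) := by
  rw [climb, hasOmega_call]
  erw [body_climb c he]
  simp [hasOmega_add, not_hasOmega_tau]

theorem not_hasOmega_gamble {c : Ch} {e : ℕ → Val} (he : e.Injective) (n : ℕ) :
    ¬ HasOmega (gamble c e n) := by
  rw [gamble, hasOmega_call]
  erw [body_gamble c he]
  rw [hasOmega_ite]
  split_ifs
  · exact not_hasOmega_nil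
  · exact not_hasOmega_tau _

theorem not_hasOmega_flip : ¬ HasOmega (flip : State Ch Val 0) := not_hasOmega_tau _

theorem deaf_wait {c : Ch} {e : ℕ → Val} : Deaf (wait c e) := fun _ _ _ h => by
  simp [stStep_wait] at h

theorem deaf_climb {c : Ch} {e : ℕ → Val} (he : e.Injective) (n : ℕ) : Deaf (climb c e n) :=
  fun _ _ _ h => by simp [stStep_climb he] at h

theorem deaf_gamble {c : Ch} {e : ℕ → Val} (he : e.Injective) (n : ℕ) : Deaf (gamble c e n) :=
  fun _ _ _ h => by simp [stStep_gamble he] at h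

theorem deaf_flip : Deaf (flip : State Ch Val 0) := fun _ _ _ h => by
  simp [stStep_flip] at h

theorem deaf_nil : Deaf (.nil : State Ch Val 0) := fun _ _ _ => not_stStep_nil

theorem deaf_omega : Deaf (.omega : State Ch Val 0) := fun _ _ _ => not_stStep_omega

/-! ### The results of the counting network have supremum one -/

/-- The probability that one of `n` coin tosses succeeds. -/
def winProb : ℕ → ℝ≥0∞
  | 0 => 0
  | n + 1 => 2⁻¹ + 2⁻¹ * winProb n

theorem winProb_add (n : ℕ) : winProb n + 2⁻¹ ^ n = 1 := by
  induction n with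
  | zero => simp [winProb]
  | succ n ih =>
    rw [winProb, pow_succ', add_assoc, ← mul_add, ih, mul_one, ENNReal.inv_two_add_inv_two]

/-- By `winProb_add` the gap between `winProb n` and one is `2⁻¹ ^ n`, which eventually falls below
`1 - q`. -/
theorem exists_le_winProb {q : ℝ≥0∞} (hq : q < 1) : ∃ n, q ≤ winProb n := by
  obtain ⟨n, hn⟩ := ENNReal.exists_inv_two_pow_lt (tsub_pos_of_lt hq).ne'
  refine ⟨n, le_of_not_gt fun h => ?_⟩
  have := ENNReal.add_lt_add h hn
  rw [winProb_add, add_tsub_cancel_of_le hq.le] at this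
  exact this.false

variable {Γ : Graph Node} {m : Node} {t : Sys Node Ch Val} {c : Ch} {e : ℕ → Val}

open TestingStructure

theorem winProb_le_one (n : ℕ) : winProb n ≤ 1 := by
  rw [← winProb_add n]
  exact le_self_add

theorem attains_gamble (he : e.Injective) (n : ℕ) :
    (netTS Node Ch Val).Attains (nodeWith Γ m (gamble c e n) t) (winProb n) := by
  classical
  induction n with
  | zero => exact attains_zero netTS_finiteSupport _
  | succ n ih =>
    -- The context `t` may already be successful; the network may then not proceed, but its result
    -- is one.
    by_cases hs : (netTS Node Ch Val).success (nodeWith Γ m (gamble c e (n + 1)) t)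
    · exact (attains_one hs).mono (winProb_le_one _)
    have hred := nodeWith_red_tau (Γ := Γ) (m := m)
      ((stStep_gamble (c := c) he).2 ⟨n, rfl, rfl, rfl⟩) t
    have := Attains.of_red hs hred (netTS_finiteSupport _ _ hred)
      (f := fun x => if x = nodeWith Γ m .omega t then 1 else winProb n) fun x hx => by
        split_ifs with h
        · rw [h]
          exact attains_one (nodeWith_success.2 (.inl .omega))
        · rw [map_coin] at hx
          rwa [(eq_or_eq_of_coin_ne_zero hx).resolve_left h]
    rw [map_coin, tsum_coin_mul, if_pos rfl, if_neg fun h =>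
      gamble_ne_omega c e n (nodeWith_inj h).1, mul_one] at this
    exact this

/-- The number `k` counts the climbing steps still to be made before gambling starts. -/
theorem attains_climb (he : e.Injective) (k n : ℕ) :
    (netTS Node Ch Val).Attains (nodeWith Γ m (climb c e n) t) (winProb (n + k)) := by
  induction k generalizing n with
  | zero =>
    by_cases hs : (netTS Node Ch Val).success (nodeWith Γ m (climb c e n) t)
    · exact (attains_one hs).mono (winProb_le_one _)
    have hred := nodeWith_red_tau (Γ := Γ) (m := m)
      ((stStep_climb (c := c) (n := n) he).2 ⟨rfl, .inr rfl⟩) t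
    refine Attains.of_red_const hs hred (netTS_finiteSupport _ _ hred) fun x hx => ?_
    rw [PMF.pure_map, ← PMF.mem_support_iff, PMF.mem_support_pure_iff] at hx
    rw [hx]
    exact attains_gamble he n
  | succ k ih =>
    by_cases hs : (netTS Node Ch Val).success (nodeWith Γ m (climb c e n) t)
    · exact (attains_one hs).mono (winProb_le_one _)
    have hred := nodeWith_red_tau (Γ := Γ) (m := m)
      ((stStep_climb (c := c) (n := n) he).2 ⟨rfl, .inl rfl⟩) t
    refine Attains.of_red_const hs hred (netTS_finiteSupport _ _ hred) fun x hx => ?_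
    rw [PMF.pure_map, ← PMF.mem_support_iff, PMF.mem_support_pure_iff] at hx
    rw [hx, show n + (k + 1) = n + 1 + k by omega]
    exact ih (n + 1)

theorem attains_wait (he : e.Injective) (n : ℕ) :
    (netTS Node Ch Val).Attains (nodeWith Γ m (wait c e) t) (winProb n) := by
  by_cases hs : (netTS Node Ch Val).success (nodeWith Γ m (wait c e) t)
  · exact (attains_one hs).mono (winProb_le_one _)
  -- The context may react to the broadcast in any way: the bound for `climb` holds next to every
  -- system.
  obtain ⟨Θ, hΘ⟩ := SysStep.exists_rcv Γ t m c (e 0)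
  have hred : Net.Red (nodeWith Γ m (wait c e) t) (Θ.map (nodeWith Γ m (climb c e 0))) :=
    ⟨_, (netDist_parDist_right Γ m _ Θ).symm, .inr ⟨m, c, e 0, .syncL _ _ _ _ _ _ _
      (nodeDist_pure (climb c e 0) m ▸ .broad _ _ _ _ _ (stStep_wait.2 (.inr ⟨rfl, rfl⟩))) hΘ⟩⟩
  refine Attains.of_red_const hs hred (netTS_finiteSupport _ _ hred) fun x hx => ?_
  obtain ⟨t', -, rfl⟩ := (PMF.mem_support_map_iff _ _ _).1 ((PMF.mem_support_iff _ _).2 hx)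
  simpa using attains_climb he n 0

/-! ### The supremum is attained whenever the single coin toss attains it -/

/-- The networks reachable from the single coin toss. -/
def flipNets (Γ : Graph Node) (m : Node) : Set (Net Node Ch Val) :=
  {x | ∃ s t, (s = flip ∨ s = .nil ∨ s = .omega) ∧ x = nodeWith Γ m s t}

/-- The weight that discards the successful branch of the coin toss and doubles the other one. -/
def stLose : State Ch Val 0 → ℝ≥0∞
  | .tau _ => 1
  | .nil => 2
  | _ => 0

/-- The weight that doubles the successful branch of the coin toss and discards the other one. -/
def stWin : State Ch Val 0 → ℝ≥0∞
  | .tau _ => 1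
  | .omega => 2
  | _ => 0

/-- The extension of a weight of states to networks with a distinguished node. -/
def netWeight (W : State Ch Val 0 → ℝ≥0∞) (x : Net Node Ch Val) : ℝ≥0∞ :=
  match x.sys with
  | .par (.node s _) _ => W s
  | _ => 0

/-- Replace the code of the distinguished node. -/
def setCode (s : State Ch Val 0) (x : Net Node Ch Val) : Net Node Ch Val :=
  match x with
  | ⟨Γ, .par (.node _ m) t⟩ => ⟨Γ, .par (.node s m) t⟩
  | x => x

theorem netWeight_nodeWith (W : State Ch Val 0 → ℝ≥0∞) (s : State Ch Val 0) :
    netWeight W (nodeWith Γ m s t) = W s := rfl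

theorem setCode_nodeWith (s s' : State Ch Val 0) :
    setCode s (nodeWith Γ m s' t) = nodeWith Γ m s t := rfl

/-- The reductions of the networks reachable from the single coin toss. -/
theorem flipNets_red_cases {x : Net Node Ch Val} (hx : x ∈ flipNets Γ m)
    {D : PMF (Net Node Ch Val)} (hs : ¬ (netTS Node Ch Val).success x)
    (h : (netTS Node Ch Val).red x D) :
    (∃ t, x = nodeWith Γ m flip t ∧ D = coin (nodeWith Γ m .omega t) (nodeWith Γ m .nil t)) ∨
    ∃ s t Θ, (s = flip ∨ s = .nil) ∧ x = nodeWith Γ m s t ∧ SysRed Γ t Θ ∧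
      D = Θ.map (nodeWith Γ m s) := by
  obtain ⟨s, t, hst, rfl⟩ := hx
  have hst' : s = flip ∨ s = .nil := by
    rcases hst with h | h | rfl
    · exact .inl h
    · exact .inr h
    · exact absurd (nodeWith_success.2 (.inl .omega)) hs
  have hdeaf : Deaf s := by
    rcases hst' with rfl | rfl
    · exact deaf_flip
    · exact deaf_nil
  rcases nodeWith_red_cases hdeaf h with ⟨Δ, h', rfl⟩ | ⟨_, _, _, _, h', -⟩ | ⟨Θ, h', rfl⟩
  · rcases hst' with rfl | rfl
    · obtain ⟨-, rfl⟩ := stStep_flip.1 h'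
      exact .inl ⟨t, rfl, map_coin _ _ _⟩
    · exact absurd h' not_stStep_nil
  · rcases hst' with rfl | rfl
    · simp [stStep_flip] at h'
    · exact absurd h' not_stStep_nil
  · exact .inr ⟨s, t, Θ, hst', rfl, h', rfl⟩

theorem closed_flipNets : (netTS Node Ch Val).Closed (flipNets Γ m) := by
  intro x hx D hs h y hy
  rcases flipNets_red_cases hx hs h with ⟨t, rfl, rfl⟩ | ⟨s, t, Θ, hst, rfl, -, rfl⟩
  · rcases eq_or_eq_of_coin_ne_zero hy with rfl | rfl
    · exact ⟨_, _, .inr (.inr rfl), rfl⟩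
    · exact ⟨_, _, .inr (.inl rfl), rfl⟩
  · obtain ⟨t', -, rfl⟩ := (PMF.mem_support_map_iff _ _ _).1 ((PMF.mem_support_iff _ _).2 hy)
    exact ⟨s, t', hst.imp id .inl, rfl⟩

/-- The toss replaces weight 1 by 2 or 0 with equal probability, so the expected weight is
preserved; moves of the context do not change it. -/
theorem tsum_stWin_le {Δ' : SubDist (Net Node Ch Val)}
    (h : (netTS Node Ch Val).HyperDer (SubDist.point (nodeWith Γ m flip t)) Δ') :
    ∑' x, Δ' x * netWeight stWin x ≤ 1 := by
  refine ((closed_flipNets (Γ := Γ) (m := m)).hyperDer_le (w := netWeight stWin) ?_ h ?_).trans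
    (SubDist.tsum_point_mul _ _).le
  · intro x hx D hs hD
    rcases flipNets_red_cases hx hs hD with ⟨t, rfl, rfl⟩ | ⟨s, t, Θ, -, rfl, -, rfl⟩
    · rw [tsum_coin_mul]
      change 2⁻¹ * 2 + 2⁻¹ * 0 ≤ 1
      rw [ENNReal.inv_mul_cancel two_ne_zero ENNReal.ofNat_ne_top, mul_zero, add_zero]
    · rw [tsum_map_mul]
      simp_rw [netWeight_nodeWith]
      rw [ENNReal.tsum_mul_right, Θ.tsum_coe, one_mul]
  · intro x hx
    by_contra hc
    exact hx (SubDist.point_of_ne fun h => hc ⟨_, _, .inl rfl, h⟩)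

/-- If the single coin toss leads to certain success in some context, then so does waiting. -/
theorem attains_wait_one {Δ' : SubDist (Net Node Ch Val)}
    (h : (netTS Node Ch Val).HyperDer (SubDist.point (nodeWith Γ m flip t)) Δ')
    (hv : 1 ≤ (netTS Node Ch Val).value Δ') :
    (netTS Node Ch Val).Attains (nodeWith Γ m (wait c e) t) 1 := by
  classical
  have hmem : ∀ x, Δ' x ≠ 0 → x ∈ flipNets Γ m := fun x hx =>
    closed_flipNets.mem_of_hyperDer h (fun y hy => by
      by_contra hc
      exact hy (SubDist.point_of_ne fun h => hc ⟨_, _, .inl rfl, h⟩)) hx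
  obtain ⟨Θ', hΘ, hΘ'⟩ := h.exists_pushW (Q := netTS Node Ch Val)
    (closed_flipNets (Γ := Γ) (m := m))
    (setCode (wait c e)) (netWeight stLose) (by
      intro x hx D hs hD _
      rcases flipNets_red_cases hx hs hD with ⟨t, rfl, rfl⟩ | ⟨s, t, Θ, -, rfl, hΘ, rfl⟩
      · refine ⟨_, nodeWith_red_tau (stStep_wait.2 (.inl ⟨rfl, rfl⟩)) t, fun y => ?_⟩
        rw [pushW_coin, PMF.pure_map]
        change 2⁻¹ * (0 * _) + 2⁻¹ * (2 * SubDist.point (nodeWith Γ m (wait c e) t) y) =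
          1 * SubDist.point (nodeWith Γ m (wait c e) t) y
        rw [zero_mul, mul_zero, zero_add, ← mul_assoc,
          ENNReal.inv_mul_cancel two_ne_zero ENNReal.ofNat_ne_top]
      · exact ⟨_, nodeWith_red_right deaf_wait hΘ, pushW_map _ _ _ _ fun _ => rfl⟩)
    -- Vacuous: within `flipNets` weight zero means code `ω`, and such networks are successful.
    (by
      intro x hx D hs hD h0
      rcases flipNets_red_cases hx hs hD with ⟨t, rfl, rfl⟩ | ⟨s, t, Θ, hst, rfl, hΘ, rfl⟩
      · exact absurd h0 one_ne_zero
      · rcases hst with rfl | rfl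
        · exact absurd h0 one_ne_zero
        · exact absurd h0 two_ne_zero)
    (by
      rintro _ ⟨s, t, -, rfl⟩ - h
      rw [setCode_nodeWith, nodeWith_success] at h
      exact nodeWith_success.2 (.inr (h.resolve_left not_hasOmega_wait)))
    ⟨_, _, .inl rfl, rfl⟩ rfl
  rw [setCode_nodeWith] at hΘ
  have hsum : 1 ≤ (netTS Node Ch Val).value Θ' := by
    have e1 : (netTS Node Ch Val).value Θ' = ∑' x, Δ' x *
        if (netTS Node Ch Val).success (setCode (wait c e) x) then netWeight stLose x else 0 := by
      rw [← tsum_pushW (setCode (wait c e))]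
      refine tsum_congr fun y => ?_
      rw [hΘ', pushW, pushW]
      split_ifs with hy
      · refine tsum_congr fun x => ?_
        split_ifs with h1 h2
        · rfl
        · exact absurd (h1 ▸ hy) h2
        · rfl
      · refine (ENNReal.tsum_eq_zero.2 fun x => ?_).symm
        split_ifs with h1 h2
        · exact absurd (h1 ▸ h2) hy
        · rw [mul_zero]
        · rfl
    -- At each successful network the two weights add up to 2: they are 1 and 1 before the toss, 2
    -- and 0 after a loss, 0 and 2 after a win. In the first two cases the success is due to the
    -- context and survives the replacement.
    have e2 : 2 * (netTS Node Ch Val).value Δ' ≤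
        (netTS Node Ch Val).value Θ' + ∑' x, Δ' x * netWeight stWin x := by
      rw [e1, value, ← ENNReal.tsum_mul_left, ← ENNReal.tsum_add]
      refine ENNReal.tsum_le_tsum fun x => ?_
      by_cases hx : Δ' x = 0
      · simp [hx]
      by_cases hsx : (netTS Node Ch Val).success x
      swap
      · simp [hsx]
      rw [if_pos hsx, ← mul_add, mul_comm]
      refine mul_le_mul_right ?_ _
      obtain ⟨s, t, hst, rfl⟩ := hmem x hx
      have key : ¬ HasOmega s →
          (netTS Node Ch Val).success (setCode (wait c e) (nodeWith Γ m s t)) := fun hs =>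
        nodeWith_success.2 (.inr ((nodeWith_success.1 hsx).resolve_left hs))
      rcases hst with rfl | rfl | rfl
      · rw [if_pos (key not_hasOmega_flip)]
        exact one_add_one_eq_two.ge
      · rw [if_pos (key not_hasOmega_nil)]
        exact le_self_add
      · exact le_add_self
    by_contra hc
    have h3 := ENNReal.add_lt_add_of_lt_of_le
      ((tsum_stWin_le h).trans_lt ENNReal.one_lt_top).ne (not_le.1 hc) (tsum_stWin_le h)
    refine (lt_irrefl (2 : ℝ≥0∞)) (lt_of_le_of_lt ?_ (one_add_one_eq_two (R := ℝ≥0∞) ▸ h3))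
    refine le_trans ?_ e2
    calc (2 : ℝ≥0∞) = 2 * 1 := (mul_one _).symm
      _ ≤ _ := mul_le_mul_right hv _
  -- Value one forces all of `Θ'` onto successful networks, so the derivation is extreme although
  -- the weighted image alone does not ensure this.
  exact ⟨_, ⟨Θ', ⟨hΘ, fun s hs _ => success_of_one_le_value hsum hs⟩, rfl⟩, hsum⟩

/-! ### The supremum is not attained by the counting network itself -/

/-- The networks reachable from the counting network. -/
def countNets (Γ : Graph Node) (m : Node) (c : Ch) (e : ℕ → Val) : Set (Net Node Ch Val) :=
  {x | ∃ s, (s = wait c e ∨ (∃ n, s = climb c e n) ∨ (∃ n, s = gamble c e n) ∨ s = .omega) ∧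
    x = nodeWith Γ m s .nil}

theorem not_sysRed_nil (Θ : PMF (Sys Node Ch Val)) : ¬ SysRed Γ .nil Θ := by
  rintro (⟨_, h⟩ | ⟨_, _, _, h⟩) <;> cases h

theorem nodeWith_nil_red_cases {s : State Ch Val 0} (hs : Deaf s) {D : PMF (Net Node Ch Val)}
    (h : Net.Red (nodeWith Γ m s .nil) D) :
    ∃ α Δ, StStep s α Δ ∧ D = Δ.map fun s => nodeWith Γ m s .nil := by
  rcases nodeWith_red_cases hs h with ⟨Δ, h', rfl⟩ | ⟨_, _, Δ, Θ, h', hΘ, rfl⟩ | ⟨Θ, h', -⟩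
  · exact ⟨_, Δ, h', rfl⟩
  · cases hΘ
    exact ⟨_, Δ, h', netDist_parDist_left _ _ _ _⟩
  · exact absurd h' (not_sysRed_nil Θ)

theorem countNets_red_cases (he : e.Injective) {x : Net Node Ch Val}
    (hx : x ∈ countNets Γ m c e) {D : PMF (Net Node Ch Val)} (h : (netTS Node Ch Val).red x D) :
    (∃ n, x = nodeWith Γ m (gamble c e (n + 1)) .nil ∧
      D = coin (nodeWith Γ m .omega .nil) (nodeWith Γ m (gamble c e n) .nil)) ∨
    ∃ s, (s = wait c e ∨ (∃ n, s = climb c e n) ∨ ∃ n, s = gamble c e n) ∧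
      (∀ n, x ≠ nodeWith Γ m (gamble c e n) .nil) ∧ D = PMF.pure (nodeWith Γ m s .nil) := by
  obtain ⟨s, hs, rfl⟩ := hx
  have hdeaf : Deaf s := by
    rcases hs with rfl | ⟨n, rfl⟩ | ⟨n, rfl⟩ | rfl
    exacts [deaf_wait, deaf_climb he n, deaf_gamble he n, deaf_omega]
  obtain ⟨α, Δ, h', rfl⟩ := nodeWith_nil_red_cases hdeaf h
  rcases hs with rfl | ⟨n, rfl⟩ | ⟨n, rfl⟩ | rfl
  · have hne : ∀ n, nodeWith Γ m (wait c e) .nil ≠ nodeWith Γ m (gamble c e n) .nil :=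
      fun n hn => wait_ne_gamble c e n (nodeWith_inj hn).1
    rcases stStep_wait.1 h' with ⟨-, rfl⟩ | ⟨-, rfl⟩
    · exact .inr ⟨_, .inl rfl, hne, PMF.pure_map _ _⟩
    · exact .inr ⟨_, .inr (.inl ⟨_, rfl⟩), hne, PMF.pure_map _ _⟩
  · have hne : ∀ k, nodeWith Γ m (climb c e n) .nil ≠ nodeWith Γ m (gamble c e k) .nil :=
      fun k hk => climb_ne_gamble c e n k (nodeWith_inj hk).1
    rcases (stStep_climb he).1 h' with ⟨-, rfl | rfl⟩
    · exact .inr ⟨_, .inr (.inl ⟨_, rfl⟩), hne, PMF.pure_map _ _⟩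
    · exact .inr ⟨_, .inr (.inr ⟨_, rfl⟩), hne, PMF.pure_map _ _⟩
  · obtain ⟨k, rfl, -, rfl⟩ := (stStep_gamble he).1 h'
    exact .inl ⟨k, rfl, map_coin _ _ _⟩
  · exact absurd h' not_stStep_omega

theorem closed_countNets (he : e.Injective) :
    (netTS Node Ch Val).Closed (countNets Γ m c e) := by
  intro x hx D _ h y hy
  rcases countNets_red_cases he hx h with ⟨n, rfl, rfl⟩ | ⟨s, hs, -, rfl⟩
  · rcases eq_or_eq_of_coin_ne_zero hy with rfl | rfl
    · exact ⟨_, .inr (.inr (.inr rfl)), rfl⟩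
    · exact ⟨_, .inr (.inr (.inl ⟨_, rfl⟩)), rfl⟩
  · rw [← PMF.mem_support_iff, PMF.mem_support_pure_iff] at hy
    exact ⟨s, by tauto, hy⟩

/-- The counting network on its own succeeds with a probability less than one. -/
theorem value_lt_one_of_hyperDer_wait (he : e.Injective) {Δ' : SubDist (Net Node Ch Val)}
    (h : (netTS Node Ch Val).HyperDer (SubDist.point (nodeWith Γ m (wait c e) .nil)) Δ') :
    (netTS Node Ch Val).value Δ' < 1 := by
  classical
  by_contra hc
  have hsucc : ∀ x, Δ' x ≠ 0 → (netTS Node Ch Val).success x := fun x =>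
    success_of_one_le_value (not_lt.1 hc)
  have hinit : ∀ x, SubDist.point (nodeWith Γ m (wait c e) .nil) x ≠ 0 →
      x = nodeWith Γ m (wait c e) .nil := by
    intro x hx
    by_contra hc
    exact hx (SubDist.point_of_ne hc)
  have hinit' : ∀ x, SubDist.point (nodeWith Γ m (wait c e) .nil) x ≠ 0 →
      x ∈ countNets Γ m c e := fun x hx => ⟨_, .inl rfl, hinit x hx⟩
  -- If the value were one, all halting mass would lie on successful networks, and the only
  -- reachable one has code `ω`.
  have hmem : ∀ x, Δ' x ≠ 0 → x = nodeWith Γ m .omega .nil := by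
    intro x hx
    obtain ⟨s, hs, rfl⟩ := (closed_countNets he).mem_of_hyperDer h hinit' hx
    have := (nodeWith_success.1 (hsucc _ hx)).resolve_right id
    rcases hs with rfl | ⟨n, rfl⟩ | ⟨n, rfl⟩ | rfl
    exacts [absurd this not_hasOmega_wait, absurd this (not_hasOmega_climb he n),
      absurd this (not_hasOmega_gamble he n), rfl]
  obtain ⟨go, halt, h0, h1, h2, h3⟩ := h
  have hgo : ∀ k x, go k x ≠ 0 → x ∈ countNets Γ m c e := fun k x =>
    (closed_countNets he).mem_of_go h0 h1 h2 hinit'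
  have hhalt : ∀ k x, halt k x ≠ 0 → Δ' x ≠ 0 := by
    intro k x hk h
    rw [h3] at h
    exact hk (ENNReal.tsum_eq_zero.1 h k)
  -- No mass can ever reach `gamble n`: it may not halt there, and proceeding would put mass on
  -- `gamble (n - 1)`, excluded by induction; `gamble 0` cannot proceed at all.
  have hno : ∀ n k, go k (nodeWith Γ m (gamble c e n) .nil) = 0 ∧
      halt k (nodeWith Γ m (gamble c e n) .nil) = 0 := by
    intro n
    induction n using Nat.strong_induction_on with
    | _ n ih =>
      intro k
      constructor
      · by_contra hk
        obtain ⟨mid, hmid, hmid'⟩ := h1 k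
        obtain ⟨μ, hμ, hne⟩ := hmid.exists_red_of_ne_zero hk
        rcases countNets_red_cases he (hgo k _ hk) hμ with ⟨j, hj, rfl⟩ | ⟨_, -, hn, -⟩
        · have hnj := gamble_injective c he (nodeWith_inj hj).1
          have := hne _ (coin_right_ne_zero _ _)
          rw [hmid', (ih j (by omega) (k + 1)).1, (ih j (by omega) (k + 1)).2, add_zero] at this
          exact this rfl
        · exact hn n rfl
      · by_contra hk
        exact gamble_ne_omega c e n (nodeWith_inj (hmem _ (hhalt k _ hk))).1
  -- The code `ω` is entered only by a toss whose other branch puts mass on some `gamble j`,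
  -- contrary to `hno`. Hence nothing halts, and the value would be zero.
  have hzero : ∀ k x, halt k x = 0 := by
    intro k x
    by_contra hk
    obtain rfl := hmem _ (hhalt k _ hk)
    cases k with
    | zero =>
      have hp : SubDist.point (nodeWith Γ m (wait c e) .nil) (nodeWith Γ m .omega .nil) ≠ 0 := by
        rw [h0]
        exact fun h => hk (add_eq_zero.1 h).2
      exact wait_ne_omega c e (nodeWith_inj (hinit _ hp)).1.symm
    | succ k =>
      obtain ⟨mid, hmid, hmid'⟩ := h1 k
      have hm : mid (nodeWith Γ m .omega .nil) ≠ 0 := by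
        rw [hmid']
        exact fun h => hk (add_eq_zero.1 h).2
      obtain ⟨s, μ, hs, hμ, hμx, hne⟩ := hmid.exists_source_of_ne_zero hm
      rcases countNets_red_cases he (hgo k _ hs) hμ with ⟨j, -, rfl⟩ | ⟨s, hs, -, rfl⟩
      · have := hne _ (coin_right_ne_zero _ _)
        rw [hmid', (hno j (k + 1)).1, (hno j (k + 1)).2, add_zero] at this
        exact this rfl
      · rw [← PMF.mem_support_iff, PMF.mem_support_pure_iff] at hμx
        have := (nodeWith_inj hμx).1
        rcases hs with rfl | ⟨n, rfl⟩ | ⟨n, rfl⟩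
        exacts [wait_ne_omega _ _ this.symm, climb_ne_omega _ _ _ this.symm,
          gamble_ne_omega _ _ _ this.symm]
  have hΔ : ∀ x, Δ' x = 0 := fun x => by rw [h3]; simp [hzero]
  refine hc ?_
  simp [value, hΔ]

/-! ### The witnesses -/

/-- The connectivity graph with the nodes `m` and `o` and the connection from `m` to `o`. -/
def edgeGraph (m o : Node) (h : m ≠ o) : Graph Node where
  verts := {m, o}
  finite := Set.toFinite _
  conn a b := a = m ∧ b = o
  conn_left _ _ h := .inl h.1
  conn_right _ _ h := .inr h.2
  irrefl _ h' := h (h'.1.symm.trans h'.2)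

/-- The network of the single node `m` with code `s` and the output node `o`. -/
def edgeNet (m o : Node) (h : m ≠ o) (s : State Ch Val 0) : Net Node Ch Val :=
  ⟨edgeGraph m o h, .node s m⟩

theorem mem_nodes_edgeNet {m o : Node} {h : m ≠ o} {s : State Ch Val 0} {n : Node} :
    n ∈ (edgeNet m o h s).nodes ↔ n = m := List.mem_singleton

theorem wellFormed_edgeNet (m o : Node) (h : m ≠ o) (s : State Ch Val 0) :
    (edgeNet m o h s).WellFormed where
  nodup := List.nodup_singleton m
  nodes_subset n hn := .inl (mem_nodes_edgeNet.1 hn)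
  internal a b hab := .inl (mem_nodes_edgeNet.2 hab.1)
  connected a ha hn := by
    rcases ha with rfl | rfl
    · exact mem_nodes_edgeNet.2 rfl
    · exact absurd ⟨m, .inr ⟨rfl, rfl⟩⟩ hn

/-- The empty network. -/
def emptyNet : Net Node Ch Val where
  graph := ⟨∅, Set.finite_empty, fun _ _ => False, fun _ _ => False.elim, fun _ _ => False.elim,
    fun _ => id⟩
  sys := .nil

theorem wellFormed_emptyNet : (emptyNet : Net Node Ch Val).WellFormed where
  nodup := List.nodup_nil
  nodes_subset _ hn := absurd hn List.not_mem_nil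
  internal _ _ h := h.elim
  connected _ h := h.elim

/-- A result below one is dominated by sufficiently many tosses; a result equal to one is reproduced
by waiting for the context to succeed. -/
theorem mayLE_flip_wait {m o : Node} (h : m ≠ o) (c : Ch) {e : ℕ → Val} (he : e.Injective) :
    MayLE (edgeNet m o h flip) (edgeNet m o h (wait c e)) := by
  refine ⟨wellFormed_edgeNet _ _ _ _, wellFormed_edgeNet _ _ _ _, rfl, rfl,
    fun T _ _ _ => ?_⟩
  rintro _ ⟨Δ', hΔ, rfl⟩
  by_cases hv : 1 ≤ (netTS Node Ch Val).value Δ'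
  · exact (attains_wait_one hΔ.1 hv).mono (value_le_one _)
  · obtain ⟨n, hn⟩ := exists_le_winProb (not_le.1 hv)
    exact (attains_wait he n).mono hn

/-- The empty test separates the two: code `ω` yields one at once, while the counting network alone
stays below one. -/
theorem not_mayLE_omega_wait {m o : Node} (h : m ≠ o) (c : Ch) {e : ℕ → Val}
    (he : e.Injective) : ¬ MayLE (edgeNet m o h .omega) (edgeNet m o h (wait c e)) := by
  rintro ⟨-, -, -, -, hT⟩
  obtain ⟨p, hp, h1⟩ := attains_one (P := netTS Node Ch Val)
    (s := (edgeNet m o h .omega).comp emptyNet) (nodeWith_success.2 (.inl .omega))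
  obtain ⟨_, ⟨Δ', hΔ, rfl⟩, hq⟩ := hT emptyNet wellFormed_emptyNet (Set.disjoint_empty _)
    (Set.disjoint_empty _) p hp
  exact (value_lt_one_of_hyperDer_wait he hΔ.1).not_ge (h1.trans hq)

theorem not_success_edgeNet_wait {m o : Node} (h : m ≠ o) (c : Ch) (e : ℕ → Val) :
    ¬ (edgeNet m o h (wait c e)).sys.Success := fun hs =>
  not_hasOmega_wait (Sys.success_iff.1 hs)

theorem eq_pure_of_forall {S : Type*} {μ : PMF S} {s : S} (h : ∀ x, μ x ≠ 0 → x = s) :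
    μ = PMF.pure s := by
  have h0 : ∀ x, x ≠ s → μ x = 0 := fun x hx => not_not.1 fun h' => hx (h x h')
  ext x
  by_cases hx : x = s
  · have := μ.tsum_coe
    rw [tsum_eq_single s h0] at this
    simp [hx, this]
  · simp [h0 x hx, hx]

/-- The waiting network does not evolve on its own. -/
theorem eq_pure_of_hyperDer_wait {m o : Node} {h : m ≠ o} {c : Ch} {e : ℕ → Val}
    {Θ : PMF (Net Node Ch Val)} (hΘ : (extTS Node Ch Val).HyperDer
      (SubDist.ofPMF (PMF.pure (edgeNet m o h (wait c e)))) (SubDist.ofPMF Θ)) :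
    Θ = PMF.pure (edgeNet m o h (wait c e)) := by
  have hclosed : (extTS Node Ch Val).Closed {edgeNet m o h (wait c e)} := by
    rintro _ rfl D _ hD x hx
    cases hD with
    | tau n Δ _ hΔ =>
      cases hΔ with
      | tau _ _ Δ hΔ =>
        rcases stStep_wait.1 hΔ with ⟨-, rfl⟩ | ⟨h, -⟩
        · rw [nodeDist_pure, netDist_pure, ← PMF.mem_support_iff,
            PMF.mem_support_pure_iff] at hx
          exact hx
        · cases h
    | silent n c' v Δ _ hΔ hn =>
      cases hΔ with
      -- The broadcast reaches the external node `o` and is therefore not an internal action; this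
      -- is the sole purpose of `o`.
      | broad => exact absurd (mem_nodes_edgeNet.1 (hn o ⟨rfl, rfl⟩)) h.symm
  refine eq_pure_of_forall fun x hx => hclosed.mem_of_hyperDer hΘ (fun y hy => ?_) hx
  by_contra hc
  exact hy (SubDist.point_of_ne hc)

/-- Point distributions are extreme points: every component of positive weight in a convex
combination equal to one is that same point distribution. -/
theorem LiftDist.of_eq_pure {S T : Type*} {R : S → PMF T → Prop} {Δ : PMF S} {Θ : PMF T}
    (h : LiftDist R Δ Θ) {t : T} (hΘ : Θ = PMF.pure t) {s : S} (hs : Δ s ≠ 0) :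
    R s (PMF.pure t) := by
  induction h with
  | point s' Θ h =>
    rw [← PMF.mem_support_iff, PMF.mem_support_pure_iff] at hs
    rwa [hs, ← hΘ]
  | sum n w Δs Θs _ ih =>
    rw [← PMF.mem_support_iff, PMF.mem_support_bind_iff] at hs
    obtain ⟨i, hi, hs⟩ := hs
    refine ih i (eq_pure_of_forall fun x hx => ?_) hs
    rw [← PMF.mem_support_pure_iff, ← hΘ, PMF.mem_support_bind_iff]
    exact ⟨i, hi, hx⟩

-- Failure of the simulations for the witnesses.

theorem extStep_flip {m o : Node} (h : m ≠ o) :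
    ExtStep (edgeNet m o h flip : Net Node Ch Val) .tau
      (coin (edgeNet m o h .omega) (edgeNet m o h .nil)) := by
  have hs : ¬ (edgeNet m o h flip : Net Node Ch Val).sys.Success := fun hs =>
    not_hasOmega_flip (Sys.success_iff.1 hs)
  have := ExtStep.tau m _ hs (.tau _ _ _ (stStep_flip.2 ⟨rfl, rfl⟩))
  rwa [nodeDist, netDist, map_coin, map_coin] at this

/-- The toss can only be matched by staying at `wait`, so its winning branch would be related to
`wait`, which soundness forbids. -/
theorem not_tauSimulation_flip_wait {m o : Node} (h : m ≠ o) (c : Ch) {e : ℕ → Val}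
    (he : e.Injective) {R : Net Node Ch Val → PMF (Net Node Ch Val) → Prop}
    (hR : IsTauSimulation R) (hsound : ∀ L K : Net Node Ch Val, R L (PMF.pure K) → MayLE L K) :
    ¬ R (edgeNet m o h flip) (PMF.pure (edgeNet m o h (wait c e))) := by
  intro hMN
  obtain ⟨Θ, hΘ, hL⟩ := (hR _ _ hMN).2.2.2 _ (extStep_flip h)
  exact not_mayLE_omega_wait h c he
    (hsound _ _ (hL.of_eq_pure (eq_pure_of_hyperDer_wait hΘ) (coin_left_ne_zero _ _)))

theorem not_simLE_flip_wait {m o : Node} (h : m ≠ o) (c : Ch) (e : ℕ → Val) :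
    ¬ SimLE (edgeNet m o h flip) (edgeNet m o h (wait c e)) := by
  rintro ⟨S, hS, hMN⟩
  have hs : ¬ (edgeNet m o h flip : Net Node Ch Val).sys.Success := fun hs =>
    not_hasOmega_flip (Sys.success_iff.1 hs)
  obtain ⟨Θ, hΘ, hL⟩ := (hS _ _ hMN).2.2.2.2.2 hs .tau _
    (.tau _ _ (hyperDer_point_of_red (P := extTS Node Ch Val) hs (extStep_flip h)))
  have hpure : ∀ {Θ : PMF (Net Node Ch Val)}, WeakExt (edgeNet m o h (wait c e)) .tau
      (SubDist.ofPMF Θ) → Θ = PMF.pure (edgeNet m o h (wait c e)) := by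
    intro Θ hΘ
    generalize ha : (ExtAct.tau : ExtAct Node Ch Val) = a at hΘ
    cases hΘ with
    | tau _ _ hΘ => exact eq_pure_of_hyperDer_wait hΘ
    | single _ _ _ _ _ hne => exact absurd ha.symm hne
    | multi => cases ha
  obtain ⟨t, ht, hSt⟩ := hL.of_eq_pure (hpure hΘ) (coin_left_ne_zero _ _)
  obtain ⟨Θ', hΘ', hsucc⟩ := (hS _ _ hSt).2.2.2.2.1 (Sys.success_iff.2 .omega)
  obtain rfl : edgeNet m o h (wait c e) = t := by
    rw [← PMF.mem_support_pure_iff, ← ht, PMF.mem_support_pure_iff]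
  rw [hpure hΘ'] at hsucc
  exact not_success_edgeNet_wait h c e (hsucc _ ((PMF.mem_support_pure_iff _ _).2 rfl))

end Witnesses

end WNet

end

theorem theorem8p2 {Node Ch Val : Type u} [Nontrivial Node] [Nonempty Ch] [Infinite Val] :
    (¬ ∃ R : Net Node Ch Val → PMF (Net Node Ch Val) → Prop, IsTauSimulation R ∧
      ∀ M N : Net Node Ch Val, M.WellFormed → N.WellFormed →
        (MayLE M N ↔ R M (PMF.pure N))) ∧
    ∃ M N : Net Node Ch Val, MayLE M N ∧ ¬ SimLE M N ∧
      ∀ R : Net Node Ch Val → PMF (Net Node Ch Val) → Prop, IsTauSimulation R →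
        (∀ L K : Net Node Ch Val, R L (PMF.pure K) → MayLE L K) → ¬ R M (PMF.pure N) := by
  obtain ⟨m, o, h⟩ := exists_pair_ne Node
  obtain ⟨c⟩ := ‹Nonempty Ch›
  have he : Function.Injective (Infinite.natEmbedding Val) := (Infinite.natEmbedding Val).injective
  refine ⟨?_, _, _, mayLE_flip_wait h c he, not_simLE_flip_wait h c _,
    fun R hR hsound => not_tauSimulation_flip_wait h c he hR hsound⟩
  rintro ⟨R, hR, hiff⟩
  refine not_tauSimulation_flip_wait h c he hR (fun L K hLK => ?_)
    ((hiff _ _ (wellFormed_edgeNet _ _ _ _) (wellFormed_edgeNet _ _ _ _)).1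
      (mayLE_flip_wait h c he))
  -- A `τ`-simulation relates only well-formed networks, so the equivalence applies to every related
  -- pair and yields soundness.
  obtain ⟨hL, hK, -⟩ := hR _ _ hLK
  exact (hiff L K hL (hK K ((PMF.mem_support_pure_iff _ _).2 rfl))).2 hLK
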